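/- All spaces are point-free: a space is the locale $[\mathbb T]$ of models of a propositional geometric theory $\mathbb T$, its frame of opens being presented by the symbols and axioms of $\mathbb T$, and a homeomorphism is an isomorphism of the frames of opens. An upper real in $[-\infty,\infty]$ is a rounded upper set of rationals $\{q : x<q\}$; arrows over an interval denote the corresponding space of upper reals, whose opens are generated by the conditions $x<q$ ($q\in\mathbb Q$). Let $[av]$ be the space of absolute values on $\mathbb Z$, i.e. of maps $|\cdot|:\mathbb Z\to\overleftarrow{[0,\infty)}$ with $|0|=0$, $|1|=1$, $|xy|=|x||y|$ and $|x+y|\le|x|+|y|$; its opens are generated by the conditions $|n|<q$ ($n\in\mathbb Z$, $0<q\in\mathbb Q$). Let $[av_{NA}]$ be the subspace of non-Archimedean absolute values, defined by $|n|<1$ for some $n\neq 0$, and $[av_A]$ the subspace of Archimedean ones (including the trivial one), defined by $1\le|n|$ for all $n\ne0$. Let $\mathbb P$ be the discrete space of prime numbers. **Corollary 4.9.** The subspace $[av_{NA}]$ of $[av]$ is open, being the join of the open subspaces $|n|<1$ for $n\neq0$, and $[av_A]$ is its closed complement. There are homeomorphisms $$[av_{NA}]\;\cong\;\mathbb P\times\overleftarrow{[-\infty,0)},\qquad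 [av_A]\;\cong\;\overleftarrow{[0,1]},$$ under which $(p,\lambda)$ corresponds to the absolute value with $|n|=\left(p^{\mathrm{ord}_p(n)}\right)^{\lambda}$ for $n\ne0$, and $\lambda\in\overleftarrow{[0,1]}$ to the absolute value with $|n|=|n|_\infty^{\lambda}$ for $n\neq0$ ($|n|_\infty$ being the usual absolute value). Here, for real $x\ge1$ and an upper real $\lambda<\infty$, $x^\lambda=\inf\{x^r : r\in\mathbb Q,\ \lambda<r\}$; that is, $x^\lambda<q$ if and only if $x^r<q$ for some rational $r>\lambda$. -/

import Mathlib

/-! ### Propositional geometric theories and the point-free spaces they present -/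

/-- Propositional geometric formulae over a signature `G` of propositional symbols: they are built
from the symbols using truth, binary conjunction and arbitrary set-indexed disjunction. -/
inductive Formula (G : Type) : Type 1
  | atom (g : G) : Formula G
  | top : Formula G
  | and (φ ψ : Formula G) : Formula G
  | or {ι : Type} (φ : ι → Formula G) : Formula G

namespace Formula

/-- Falsity, the empty disjunction. -/
def bot {G : Type} : Formula G := or (fun i : Empty => i.elim)

/-- Renaming of propositional symbols. -/
def map {G H : Type} (f : G → H) : Formula G → Formula H
  | atom g => atom (f g)
  | top => top
  | and φ ψ => and (φ.map f) (ψ.map f)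
  | or φ => or (fun i => (φ i).map f)

/-- The interpretation of a formula in a frame, for a given interpretation of the symbols. -/
def eval {G L : Type} [Order.Frame L] (v : G → L) : Formula G → L
  | atom g => v g
  | top => ⊤
  | and φ ψ => φ.eval v ⊓ ψ.eval v
  | or φ => ⨆ i, (φ i).eval v

end Formula

/-- The free frame on `G`: the lower sets of the free meet-semilattice on `G`. The latter consists of
the finite subsets of `G` (a finite set stands for the conjunction of its elements) ordered by
reverse inclusion. -/
abbrev FreeFrame (G : Type) : Type := LowerSet (Finset G)ᵒᵈ

/-- The generator of the free frame given by the symbol `g`. -/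
def FreeFrame.gen {G : Type} (g : G) : FreeFrame G := LowerSet.Iic (OrderDual.toDual {g})

/-- A propositional geometric theory over the signature `G`, given by its axioms:
`T φ ψ` says that the sequent `φ → ψ` is an axiom of `T`. -/
abbrev Theory (G : Type) : Type 1 := Formula G → Formula G → Prop

namespace Theory

variable {G H : Type}

/-- The space of models of the theory `T`, as a sublocale of the free locale on the signature: it is
the largest sublocale in which `φ ≤ ψ` for every axiom `φ → ψ` of `T`. As a frame (the frame of opens of
the space), it is the frame presented by the generators `G` and the relations `φ ≤ ψ`. -/
def space (T : Theory G) : Sublocale (FreeFrame G) where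
  carrier := {x | ∀ φ ψ, T φ ψ → ψ.eval FreeFrame.gen ⇨ x ≤ φ.eval FreeFrame.gen ⇨ x}
  sInf_mem' s hs φ ψ h := by
    rw [le_himp_iff]
    refine le_sInf fun x hx => ?_
    rw [← le_himp_iff]
    exact (himp_le_himp_left (sInf_le hx)).trans (hs hx φ ψ h)
  himp_mem' a b hb φ ψ h := by
    rw [himp_left_comm (ψ.eval FreeFrame.gen), himp_left_comm (φ.eval FreeFrame.gen)]
    exact himp_le_himp_left (hb φ ψ h)

/-- The open of the space of models of `T` that is defined by a formula. -/
def opens (T : Theory G) (φ : Formula G) : T.space := T.space.restrict (φ.eval FreeFrame.gen)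

/-- The theory of pairs consisting of a model of `S` and a model of `T`; its space of models is the
product of the two spaces. -/
inductive prod (S : Theory G) (T : Theory H) : Theory (G ⊕ H)
  | fst {φ ψ : Formula G} (h : S φ ψ) : prod S T (φ.map Sum.inl) (ψ.map Sum.inl)
  | snd {φ ψ : Formula H} (h : T φ ψ) : prod S T (φ.map Sum.inr) (ψ.map Sum.inr)

end Theory

/-- The open sublocale given by an open `u`. -/
def openSublocale {X : Type} [Order.Frame X] (u : X) : Sublocale X where
  carrier := {x | u ⇨ x ≤ x}
  sInf_mem' s hs :=
    le_sInf fun x hx => (himp_le_himp_left (sInf_le hx)).trans (hs hx)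
  himp_mem' a b hb := by
    change u ⇨ (a ⇨ b) ≤ a ⇨ b
    rw [himp_left_comm]
    exact himp_le_himp_left hb

/-- The closed sublocale given by an open `u`, that is, the complement of the open sublocale. -/
def closedSublocale {X : Type} [Order.Frame X] (u : X) : Sublocale X where
  carrier := {x | u ≤ x}
  sInf_mem' _ hs := le_sInf fun _ hx => hs hx
  himp_mem' _ _ hb := le_trans hb le_himp

/-! ### The discrete space on a set -/

/-- The theory of elements of a set `P`, the symbol `p` standing for "the element is `p`". -/
inductive DiscreteTheory (P : Type) : Theory P
  | exists_eq : DiscreteTheory P .top (.or fun p : P => .atom p)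
  | unique (p p' : P) (h : p ≠ p') : DiscreteTheory P (.and (.atom p) (.atom p')) .bot

/-! ### Upper reals -/

/-- The theory of upper reals in `[-∞, ∞]`, that is, of rounded upper sets of rationals. The symbol `q`
stands for `x < q`. -/
inductive UpperReal : Theory ℚ
  | rounded (q : ℚ) : UpperReal (.atom q) (.or fun r : {r : ℚ // r < q} => .atom r.1)
  | upward (r q : ℚ) (h : r < q) : UpperReal (.atom r) (.atom q)

/-- The theory of upper reals in `[-∞, 0)`. -/
inductive UpperRealNeg : Theory ℚ
  | upperReal {φ ψ : Formula ℚ} (h : UpperReal φ ψ) : UpperRealNeg φ ψ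
  | lt_zero : UpperRealNeg .top (.atom 0)

/-- The theory of upper reals in `[0, 1]`. -/
inductive UpperRealUnit : Theory ℚ
  | upperReal {φ ψ : Formula ℚ} (h : UpperReal φ ψ) : UpperRealUnit φ ψ
  | zero_le : UpperRealUnit (.atom 0) .bot
  | le_one (q : ℚ) (h : 1 < q) : UpperRealUnit .top (.atom q)

/-! ### Absolute values -/

/-- The positive rationals. -/
abbrev PosRat : Type := {q : ℚ // 0 < q}

/-- The formula `|x| < q`. -/
def absLT {R : Type} (x : R) (q : PosRat) : Formula (R × PosRat) := .atom (x, q)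

/-- The theory of absolute values on `R` with values in the upper reals in `[0, ∞)`: the first three
axioms say that each `|x|` is such an upper real, the others that `|0| = 0`, `|1| = 1`,
`|x * y| = |x| * |y|` and `|x + y| ≤ |x| + |y|`. -/
inductive AbsVal (R : Type) [CommRing R] : Theory (R × PosRat)
  | rounded (x : R) (q : PosRat) :
      AbsVal R (absLT x q) (.or fun r : {r : PosRat // r < q} => absLT x r.1)
  | upward (x : R) (r q : PosRat) (h : r < q) : AbsVal R (absLT x r) (absLT x q)
  | finite (x : R) : AbsVal R .top (.or fun q : PosRat => absLT x q)
  | zero (q : PosRat) : AbsVal R .top (absLT 0 q)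
  | one_le (q : PosRat) (h : q ≤ 1) : AbsVal R (absLT 1 q) .bot
  | le_one (q : PosRat) (h : 1 < q) : AbsVal R .top (absLT 1 q)
  | mul_le (x y : R) (r s : PosRat) :
      AbsVal R (.and (absLT x r) (absLT y s)) (absLT (x * y) (r * s))
  | le_mul (x y : R) (q : PosRat) :
      AbsVal R (absLT (x * y) q)
        (.or fun i : {i : PosRat × PosRat // i.1 * i.2 ≤ q} =>
          .and (absLT x i.1.1) (absLT y i.1.2))
  | add (x y : R) (r s : PosRat) :
      AbsVal R (.and (absLT x r) (absLT y s)) (absLT (x + y) (r + s))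

/-- The formula saying that `|n| < 1` for some non-zero integer `n`. -/
def someSmall : Formula (ℤ × PosRat) := .or fun n : {n : ℤ // n ≠ 0} => absLT n.1 1

/-- The theory of non-Archimedean absolute values on `ℤ`: `|n| < 1` for some `n ≠ 0`. -/
inductive NonArch : Theory (ℤ × PosRat)
  | absVal {φ ψ : Formula (ℤ × PosRat)} (h : AbsVal ℤ φ ψ) : NonArch φ ψ
  | small : NonArch .top someSmall

/-- The theory of Archimedean absolute values on `ℤ`: `1 ≤ |n|` for all `n ≠ 0`. The trivial
absolute value is one of them. -/
inductive Arch : Theory (ℤ × PosRat)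
  | absVal {φ ψ : Formula (ℤ × PosRat)} (h : AbsVal ℤ φ ψ) : Arch φ ψ
  | one_le (n : ℤ) (h : n ≠ 0) : Arch (absLT n 1) .bot

/-! Two arguments are combined. The subspace claims are formal: an axiom `⊤ → χ` cuts out the open
sublocale of `χ`, axioms `χᵢ → ⊥` cut out the closed complement of the join of the `χᵢ`, and the two
sublocales are complementary inside any sublocale.

The homeomorphisms are reduced to ordinary points. All theories involved are countable, so by the
Rasiowa–Sikorski lemma there are enough `Prop`-valued models to decide inclusions of opens given by
countable formulae (`Theory.IsCountable.opens_le_iff`). Hence two explicit interpretations that are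
mutually inverse on models induce an isomorphism of frames (`Theory.exists_orderIso`).

It remains to classify models. A model of `AbsVal ℤ` is a multiplicative seminorm `N`
(`absVal_isModel_iff`). If `N n < 1` for some `n ≠ 0`, then `N p < 1` for some prime `p`; integers
coprime to `p` have value 1, so `N n = t ^ ord_p n` with `t = N p` in `[0, 1)`, and `t = p ^ λ` with
`λ` in `[-∞, 0)`, where `t = 0` is `λ = -∞`. If `N ≥ 1` off zero, then `N` extends to `ℚ` and
Ostrowski's theorem gives `N n = |n| ^ λ`, with `0 ≤ λ ≤ 1`. -/

namespace Formula

/-! ### Countable formulae, substitution and evaluation -/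

variable {G H L : Type}

/-- A formula all of whose disjunctions are countable. -/
def IsCountable : Formula G → Prop
  | atom _ => True
  | top => True
  | and φ ψ => φ.IsCountable ∧ ψ.IsCountable
  | or (ι := ι) φ => Countable ι ∧ ∀ i, (φ i).IsCountable

/-- Substitution of formulae for propositional symbols. -/
def subst (σ : G → Formula H) : Formula G → Formula H
  | atom g => σ g
  | top => top
  | and φ ψ => and (φ.subst σ) (ψ.subst σ)
  | or φ => or (fun i => (φ i).subst σ)

theorem IsCountable.subst {σ : G → Formula H} (hσ : ∀ g, (σ g).IsCountable) {φ : Formula G}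
    (hφ : φ.IsCountable) : (φ.subst σ).IsCountable := by
  induction φ with
  | atom g => exact hσ g
  | top => trivial
  | and φ ψ ih ih' => exact ⟨ih hφ.1, ih' hφ.2⟩
  | or φ ih => exact ⟨hφ.1, fun i => ih i (hφ.2 i)⟩

theorem IsCountable.map {f : G → H} {φ : Formula G} (hφ : φ.IsCountable) :
    (φ.map f).IsCountable := by
  induction φ with
  | atom g => trivial
  | top => trivial
  | and φ ψ ih ih' => exact ⟨ih hφ.1, ih' hφ.2⟩
  | or φ ih => exact ⟨hφ.1, fun i => ih i (hφ.2 i)⟩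

theorem isCountable_bot : (bot : Formula G).IsCountable := ⟨inferInstance, fun i => i.elim⟩

theorem eval_subst [Order.Frame L] (σ : G → Formula H) (v : H → L) (φ : Formula G) :
    (φ.subst σ).eval v = φ.eval fun g => (σ g).eval v := by
  induction φ with
  | atom g => rfl
  | top => rfl
  | and φ ψ ih ih' => simp only [subst, eval, ih, ih']
  | or φ ih => simp only [subst, eval, ih]

theorem eval_map [Order.Frame L] (f : G → H) (v : H → L) (φ : Formula G) :
    (φ.map f).eval v = φ.eval fun g => v (f g) := by
  induction φ with
  | atom g => rfl
  | top => rfl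
  | and φ ψ ih ih' => simp only [map, eval, ih, ih']
  | or φ ih => simp only [map, eval, ih]

theorem map_eval {M : Type} [Order.Frame L] [Order.Frame M] (f : FrameHom L M) (v : G → L)
    (φ : Formula G) : f (φ.eval v) = φ.eval fun g => f (v g) := by
  induction φ with
  | atom g => rfl
  | top => exact map_top f
  | and φ ψ ih ih' => simp only [eval, map_inf, ih, ih']
  | or φ ih => simp only [eval, map_iSup, ih]

section PropValued

variable (v : G → Prop)

@[simp] theorem eval_atom (g : G) : (atom g).eval v ↔ v g := Iff.rfl

@[simp] theorem eval_top : (top : Formula G).eval v := trivial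

@[simp] theorem eval_and (φ ψ : Formula G) : (and φ ψ).eval v ↔ φ.eval v ∧ ψ.eval v := Iff.rfl

@[simp] theorem eval_or {ι : Type} (φ : ι → Formula G) :
    (or φ).eval v ↔ ∃ i, (φ i).eval v := by
  simp [eval]

@[simp] theorem eval_bot : ¬ (bot : Formula G).eval v := by
  simp [bot]

end PropValued

/-- The disjunctions occurring in a formula, as families of values in a frame. -/
def joins [Order.Frame L] (v : G → L) : Formula G → Set (Set L)
  | atom _ => ∅
  | top => ∅
  | and φ ψ => φ.joins v ∪ ψ.joins v
  | or φ => insert (Set.range fun i => (φ i).eval v) (⋃ i, (φ i).joins v)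

theorem IsCountable.countable_joins [Order.Frame L] (v : G → L) {φ : Formula G}
    (hφ : φ.IsCountable) : (φ.joins v).Countable := by
  induction φ with
  | atom g => exact Set.countable_empty
  | top => exact Set.countable_empty
  | and φ ψ ih ih' => exact (ih hφ.1).union (ih' hφ.2)
  | or φ ih =>
    have := hφ.1
    exact (Set.countable_iUnion fun i => ih i (hφ.2 i)).insert _

/-- If a filter preserves the disjunctions occurring in a formula, then it contains the value of the
formula if and only if the formula is true in the valuation defined by the filter. -/
theorem eval_mem_iff [Order.Frame L] (F : Order.PFilter L) (v : G → L) (φ : Formula G)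
    (hF : ∀ J ∈ φ.joins v, sSup J ∈ F → ∃ c ∈ J, c ∈ F) :
    φ.eval v ∈ F ↔ φ.eval fun g => v g ∈ F := by
  induction φ with
  | atom g => rfl
  | top => exact iff_of_true F.top_mem trivial
  | and φ ψ ih ih' =>
    rw [eval_and, ← ih fun J hJ => hF J (Or.inl hJ), ← ih' fun J hJ => hF J (Or.inr hJ)]
    exact F.inf_mem_iff
  | or φ ih =>
    rw [eval_or]
    have ih' i := ih i fun J hJ => hF J (Or.inr (Set.mem_iUnion.2 ⟨i, hJ⟩))
    constructor
    · intro h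
      obtain ⟨_, ⟨i, rfl⟩, hi⟩ := hF _ (Or.inl rfl) h
      exact ⟨i, (ih' i).1 hi⟩
    · rintro ⟨i, hi⟩
      exact F.mem_of_le (le_iSup (fun i => (φ i).eval v) i) ((ih' i).2 hi)

/-- The conjunction of a list of symbols. -/
def conj : List G → Formula G
  | [] => top
  | g :: l => and (atom g) (conj l)

theorem isCountable_conj (l : List G) : (conj l).IsCountable := by
  induction l with
  | nil => trivial
  | cons g l ih => exact ⟨trivial, ih⟩

theorem mem_eval_conj (l : List G) (t : (Finset G)ᵒᵈ) :
    t ∈ (conj l).eval FreeFrame.gen ↔ ∀ g ∈ l, g ∈ OrderDual.ofDual t := by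
  induction l with
  | nil => simp [conj, eval]
  | cons g l ih =>
    have : t ∈ FreeFrame.gen g ↔ g ∈ OrderDual.ofDual t := by
      rw [FreeFrame.gen, LowerSet.mem_Iic_iff, ← OrderDual.ofDual_le_ofDual]
      exact Finset.singleton_subset_iff
    simp [conj, eval, ih, this]

/-- A lower set is the union of the principal lower sets of its elements. Each of these is a finite
conjunction of generators, and there are only countably many finite sets of symbols. -/
theorem exists_eval_gen_eq [Countable G] (x : FreeFrame G) :
    ∃ φ : Formula G, φ.IsCountable ∧ φ.eval FreeFrame.gen = x := by
  refine ⟨or fun s : {s : Finset G // OrderDual.toDual s ∈ x} => conj s.1.toList,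
    ⟨inferInstance, fun _ => isCountable_conj _⟩, ?_⟩
  ext t
  simp only [eval, LowerSet.coe_iSup, Set.mem_iUnion, SetLike.mem_coe, mem_eval_conj,
    Finset.mem_toList]
  constructor
  · rintro ⟨s, hs⟩
    exact x.lower (show t ≤ OrderDual.toDual s.1 from hs) s.2
  · intro ht
    exact ⟨⟨OrderDual.ofDual t, ht⟩, fun _ h => h⟩

end Formula

/-! ### Generic filters, soundness and completeness -/

/-- The Rasiowa–Sikorski lemma for frames. -/
theorem Order.Frame.exists_pfilter {L : Type*} [Order.Frame L] {a b : L} (hab : ¬ a ≤ b)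
    {𝒥 : Set (Set L)} (h𝒥 : 𝒥.Countable) :
    ∃ F : Order.PFilter L, a ∈ F ∧ b ∉ F ∧ ∀ J ∈ 𝒥, sSup J ∈ F → ∃ c ∈ J, c ∈ F := by
  -- The empty family is added only so that there is something to enumerate.
  obtain ⟨f, hf⟩ := (h𝒥.insert ∅).exists_eq_range (Set.insert_nonempty _ _)
  have step (n : ℕ) (x : {x : L // ¬ x ≤ b}) : ∃ y : {x : L // ¬ x ≤ b}, y.1 ≤ x.1 ∧
      (x.1 ≤ sSup (f n) → ∃ c ∈ f n, y.1 ≤ c) := by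
    by_cases hx : x.1 ≤ sSup (f n)
    -- By distributivity `x` is the join of the `x ⊓ c`, so these cannot all lie below `b`.
    · obtain ⟨c, hc, hcb⟩ : ∃ c ∈ f n, ¬ x.1 ⊓ c ≤ b := by
        by_contra! h
        refine x.2 ?_
        rw [← inf_eq_left.2 hx, inf_sSup_eq]
        exact iSup₂_le h
      exact ⟨⟨_, hcb⟩, inf_le_left, fun _ => ⟨c, hc, inf_le_right⟩⟩
    · exact ⟨x, le_rfl, fun h => (hx h).elim⟩
  choose next hle hnext using step
  -- Stage `n` treats the family numbered by the first component of `n.unpair`. Every family thus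
  -- recurs at arbitrarily late stages, in particular after its join has entered the filter.
  let u : ℕ → {x : L // ¬ x ≤ b} := fun n =>
    Nat.rec ⟨a, hab⟩ (fun n x => next n.unpair.1 x) n
  have hu : Antitone fun n => (u n).1 := antitone_nat_of_succ_le fun n => hle _ _
  have hF : Order.IsPFilter {x | ∃ n, (u n).1 ≤ x} := by
    refine Order.IsPFilter.of_def ⟨_, 0, le_rfl⟩ ?_ ?_
    · rintro x ⟨m, hm⟩ y ⟨n, hn⟩
      exact ⟨(u (max m n)).1, ⟨_, le_rfl⟩, (hu (le_max_left m n)).trans hm,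
        (hu (le_max_right m n)).trans hn⟩
    · rintro x y hxy ⟨n, hn⟩
      exact ⟨n, hn.trans hxy⟩
  refine ⟨hF.toPFilter, ⟨0, le_rfl⟩, fun ⟨n, hn⟩ => (u n).2 hn, ?_⟩
  rintro J hJ ⟨n, hn⟩
  obtain ⟨k, rfl⟩ : J ∈ Set.range f := hf ▸ Or.inr hJ
  have h := hnext k (u (Nat.pair k n)) ((hu (Nat.right_le_pair k n)).trans hn)
  obtain ⟨c, hc, hle⟩ := h
  refine ⟨c, hc, Nat.pair k n + 1, ?_⟩
  change (next (Nat.unpair (Nat.pair k n)).1 (u (Nat.pair k n))).1 ≤ c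
  rwa [Nat.unpair_pair]

namespace Theory

variable {G H : Type}

/-- The models of a theory in the usual sense, with truth values in `Prop`. -/
def IsModel (T : Theory G) (v : G → Prop) : Prop := ∀ φ ψ, T φ ψ → φ.eval v → ψ.eval v

/-- A theory such that the succedents of its axioms are countable in number and contain countable
disjunctions only. -/
def IsCountable (T : Theory G) : Prop :=
  ∃ S : Set (Formula G), S.Countable ∧ ∀ φ ψ, T φ ψ → ψ ∈ S ∧ ψ.IsCountable

theorem opens_eq_eval (T : Theory G) (φ : Formula G) :
    T.opens φ = φ.eval fun g => T.space.restrict (FreeFrame.gen g) :=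
  Formula.map_eval _ _ _

theorem restrict_le_iff {X : Type} [Order.Frame X] (S : Sublocale X) {a : X} {s : S} :
    S.restrict a ≤ s ↔ a ≤ s.1 :=
  S.giRestrict.gc a s

/-- The condition defining `T.space` is applied to the element `T.opens ψ` itself, for which the
implication from `ψ` is `⊤`. -/
theorem opens_le_of_axiom {T : Theory G} {φ ψ : Formula G} (h : T φ ψ) :
    T.opens φ ≤ T.opens ψ := by
  rw [opens, restrict_le_iff, ← himp_eq_top_iff, eq_top_iff]
  refine le_trans ?_ ((T.opens ψ).2 φ ψ h)
  rw [top_le_iff, himp_eq_top_iff]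
  exact T.space.giRestrict.gc.le_u_l _

/-- Soundness. -/
theorem IsModel.eval_of_opens_le {T : Theory G} {v : G → Prop} (hv : T.IsModel v)
    {φ ψ : Formula G} (h : T.opens φ ≤ T.opens ψ) (hφ : φ.eval v) : ψ.eval v := by
  -- The prime element of the free frame corresponding to the point `v`: a formula lies below `m`
  -- exactly when it is false at `v`. Primeness also puts `m` in `T.space` when `v` is a model.
  let m : FreeFrame G := ⟨{s | ∃ g ∈ OrderDual.ofDual s, ¬ v g}, by
    rintro s t hst ⟨g, hg, hvg⟩
    exact ⟨g, hst hg, hvg⟩⟩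
  have mem_gen (g : G) (s : (Finset G)ᵒᵈ) : s ∈ FreeFrame.gen g ↔ g ∈ OrderDual.ofDual s := by
    rw [FreeFrame.gen, LowerSet.mem_Iic_iff, ← OrderDual.ofDual_le_ofDual]
    exact Finset.singleton_subset_iff
  classical
  have inf_le (x y : FreeFrame G) (hxy : x ⊓ y ≤ m) : x ≤ m ∨ y ≤ m := by
    by_contra! hn
    obtain ⟨⟨s, hs, hsm⟩, t, ht, htm⟩ := And.imp Set.not_subset.1 Set.not_subset.1 hn
    obtain ⟨g, hg, hvg⟩ := hxy (show OrderDual.toDual (OrderDual.ofDual s ∪ OrderDual.ofDual t) ∈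
      x ⊓ y from ⟨x.lower (show _ ≤ s from Finset.subset_union_left) hs,
        y.lower (show _ ≤ t from Finset.subset_union_right) ht⟩)
    rcases Finset.mem_union.1 hg with hg | hg
    · exact hsm ⟨g, hg, hvg⟩
    · exact htm ⟨g, hg, hvg⟩
  have key (χ : Formula G) : χ.eval FreeFrame.gen ≤ m ↔ ¬ χ.eval v := by
    induction χ with
    | atom g =>
      change FreeFrame.gen g ≤ m ↔ ¬ v g
      constructor
      · intro hg
        obtain ⟨g', hg', hv'⟩ := hg (show OrderDual.toDual {g} ∈ FreeFrame.gen g by simp [mem_gen])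
        rwa [Finset.mem_singleton.1 hg'] at hv'
      · intro hg s hs
        exact ⟨g, (mem_gen g s).1 hs, hg⟩
    | top =>
      refine iff_of_false (fun hm => ?_) (fun hm => hm trivial)
      obtain ⟨g, hg, -⟩ := hm (show OrderDual.toDual ∅ ∈ (⊤ : FreeFrame G) from trivial)
      simp at hg
    | and χ χ' ih ih' =>
      rw [Formula.eval_and, not_and_or, ← ih, ← ih']
      exact ⟨inf_le _ _, fun h => h.elim (inf_le_left.trans ·) (inf_le_right.trans ·)⟩
    | or χ ih =>
      rw [Formula.eval_or, not_exists]
      exact iSup_le_iff.trans (forall_congr' ih)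
  have hm : m ∈ T.space := by
    intro χ χ' hχ
    rw [le_himp_iff]
    by_cases h' : χ'.eval v
    · have hnot := mt (key χ').1 (not_not.2 h')
      exact inf_le_left.trans ((inf_le _ _ (himp_inf_le (a := χ'.eval FreeFrame.gen))).resolve_right
        hnot)
    · exact inf_le_right.trans ((key χ).2 fun hc => h' (hv _ _ hχ hc))
  by_contra hψ
  have h1 : T.opens ψ ≤ ⟨m, hm⟩ := (restrict_le_iff _).2 ((key ψ).2 hψ)
  exact (key φ).1 ((restrict_le_iff _).1 (h.trans h1)) hφ

/-- Completeness of countable theories: their spaces of models are spatial. -/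
theorem IsCountable.opens_le_iff {T : Theory G} (hT : T.IsCountable) {φ ψ : Formula G}
    (hφ : φ.IsCountable) :
    T.opens φ ≤ T.opens ψ ↔ ∀ v, T.IsModel v → φ.eval v → ψ.eval v := by
  refine ⟨fun h v hv => hv.eval_of_opens_le h, fun h => ?_⟩
  by_contra hn
  obtain ⟨S, hS, hTS⟩ := hT
  set w : G → T.space := fun g => T.space.restrict (FreeFrame.gen g) with hw
  -- The filter has to respect only the disjunctions in `φ` and in succedents of axioms.
  have h𝒥 : (φ.joins w ∪ ⋃ χ ∈ {χ ∈ S | χ.IsCountable}, χ.joins w).Countable :=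
    (hφ.countable_joins w).union ((hS.mono (Set.sep_subset _ _)).biUnion
      fun χ hχ => hχ.2.countable_joins w)
  obtain ⟨F, hφF, hψF, hF⟩ := Order.Frame.exists_pfilter hn h𝒥
  -- This direction holds for every filter, which is why antecedents of axioms and `ψ` may contain
  -- uncountable disjunctions.
  have eval_imp (χ : Formula G) (hχ : χ.eval fun g => w g ∈ F) : χ.eval w ∈ F := by
    induction χ with
    | atom g => exact hχ
    | top => exact F.top_mem
    | and χ χ' ih ih' => exact F.inf_mem_iff.2 ⟨ih hχ.1, ih' hχ.2⟩
    | or χ ih =>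
      obtain ⟨i, hi⟩ := (Formula.eval_or _ _).1 hχ
      exact F.mem_of_le (le_iSup (fun i => (χ i).eval w) i) (ih i hi)
  have hmodel : T.IsModel fun g => w g ∈ F := by
    intro χ χ' hχ h1
    have h2 := F.mem_of_le (opens_le_of_axiom hχ) (opens_eq_eval T χ ▸ eval_imp χ h1)
    rw [opens_eq_eval] at h2
    refine (Formula.eval_mem_iff F w χ' fun J hJ => hF J (Or.inr ?_)).1 h2
    exact Set.mem_biUnion (x := χ') (hTS _ _ hχ) hJ
  rw [opens_eq_eval] at hφF hψF
  exact hψF (eval_imp ψ (h _ hmodel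
    ((Formula.eval_mem_iff F w φ fun J hJ => hF J (Or.inl hJ)).1 hφF)))

theorem exists_opens_eq [Countable G] (T : Theory G) (x : T.space) :
    ∃ φ : Formula G, φ.IsCountable ∧ T.opens φ = x := by
  obtain ⟨φ, hφ, h⟩ := Formula.exists_eval_gen_eq x.1
  exact ⟨φ, hφ, by rw [opens, h]; exact T.space.giRestrict.l_u_eq x⟩

/-- Interpretations of two countable theories in each other that are mutually inverse on models
give a homeomorphism between the spaces of models. -/
theorem exists_orderIso [Countable G] [Countable H] {T : Theory G} {S : Theory H}
    (hT : T.IsCountable) (hS : S.IsCountable)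
    (σ : G → Formula H) (hσ : ∀ g, (σ g).IsCountable)
    (τ : H → Formula G) (hτ : ∀ h, (τ h).IsCountable)
    (hσm : ∀ v, S.IsModel v → T.IsModel fun g => (σ g).eval v)
    (hτm : ∀ w, T.IsModel w → S.IsModel fun h => (τ h).eval w)
    (hτσ : ∀ v, S.IsModel v → ∀ h, (τ h).eval (fun g => (σ g).eval v) ↔ v h)
    (hστ : ∀ w, T.IsModel w → ∀ g, (σ g).eval (fun h => (τ h).eval w) ↔ w g) :
    ∃ e : T.space ≃o S.space, ∀ g, e (T.opens (.atom g)) = S.opens (σ g) := by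
  choose r hr hrx using T.exists_opens_eq
  -- Every model of `T` is, up to equivalence, the `σ`-image of a model of `S`, so substitution both
  -- preserves and reflects entailment.
  have le_iff {φ ψ : Formula G} (hφ : φ.IsCountable) :
      S.opens (φ.subst σ) ≤ S.opens (ψ.subst σ) ↔ T.opens φ ≤ T.opens ψ := by
    rw [hS.opens_le_iff (hφ.subst hσ), hT.opens_le_iff hφ]
    simp only [Formula.eval_subst]
    refine ⟨fun h w hw => ?_, fun h v hv => h _ (hσm v hv)⟩
    have := h _ (hτm w hw)
    rwa [funext fun g => propext (hστ w hw g)] at this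
  have eq_of {φ ψ : Formula G} (hφ : φ.IsCountable) (hψ : ψ.IsCountable)
      (h : T.opens φ = T.opens ψ) : S.opens (φ.subst σ) = S.opens (ψ.subst σ) :=
    le_antisymm ((le_iff hφ).2 h.le) ((le_iff hψ).2 h.ge)
  let f : T.space ↪o S.space := OrderEmbedding.ofMapLEIff (fun x => S.opens ((r x).subst σ))
    fun x y => by rw [le_iff (hr x), hrx, hrx]
  have hf {φ : Formula G} (hφ : φ.IsCountable) : f (T.opens φ) = S.opens (φ.subst σ) :=
    eq_of (hr _) hφ (hrx _)
  have hsurj : Function.Surjective f := by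
    intro y
    obtain ⟨ψ, hψ, rfl⟩ := S.exists_opens_eq y
    refine ⟨T.opens (ψ.subst τ), (hf (hψ.subst hτ)).trans ?_⟩
    have key (v) (hv : S.IsModel v) : ((ψ.subst τ).subst σ).eval v ↔ ψ.eval v := by
      rw [Formula.eval_subst, Formula.eval_subst, funext fun h => propext (hτσ v hv h)]
    exact le_antisymm
      ((hS.opens_le_iff ((hψ.subst hτ).subst hσ)).2 fun v hv => (key v hv).1)
      ((hS.opens_le_iff hψ).2 fun v hv => (key v hv).2)
  exact ⟨RelIso.ofSurjective f hsurj, fun g => hf (φ := .atom g) trivial⟩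

end Theory

/-! ### Open and closed complements -/

section Sublocale

variable {X : Type} [Order.Frame X]

theorem inf_openSublocale_inf_closedSublocale (S : Sublocale X) (u : X) :
    (S ⊓ openSublocale u) ⊓ (S ⊓ closedSublocale u) = ⊥ := by
  rw [← le_bot_iff]
  intro x hx
  have h1 : u ⇨ x ≤ x := (inf_le_left.trans inf_le_right : _ ≤ openSublocale u) hx
  have h2 : u ≤ x := (inf_le_right.trans inf_le_right : _ ≤ closedSublocale u) hx
  rw [himp_eq_top_iff.2 h2, top_le_iff] at h1
  rw [h1]
  exact Sublocale.top_mem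

/-- Each `x` in `S` is the meet of `u ⇨ x`, which lies in the open part, and the reflection of `u ⊔
x` into `S`, which lies in the closed part. -/
theorem inf_openSublocale_sup_closedSublocale (S : Sublocale X) (u : X) :
    (S ⊓ openSublocale u) ⊔ (S ⊓ closedSublocale u) = S := by
  refine le_antisymm (sup_le inf_le_left inf_le_left) fun x hx => ?_
  have mem_inf {A B : Sublocale X} {y : X} (hA : y ∈ A) (hB : y ∈ B) : y ∈ A ⊓ B := by
    let C : Sublocale X := ⟨A ∩ B, fun s hs => ⟨A.sInf_mem' s fun _ h => (hs h).1,
      B.sInf_mem' s fun _ h => (hs h).2⟩, fun a b hb => ⟨A.himp_mem' a b hb.1,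
      B.himp_mem' a b hb.2⟩⟩
    exact (le_inf (fun _ h => h.1) (fun _ h => h.2) : C ≤ A ⊓ B) ⟨hA, hB⟩
  have h1 : u ⇨ x ∈ S ⊓ openSublocale u := mem_inf (S.himp_mem hx)
    (show u ⇨ (u ⇨ x) ≤ u ⇨ x by rw [himp_himp, inf_idem])
  have h2 : (S.restrict (u ⊔ x)).1 ∈ S ⊓ closedSublocale u := mem_inf (S.restrict (u ⊔ x)).2
    (show u ≤ _ from le_sup_left.trans (S.giRestrict.gc.le_u_l _))
  have h3 : x = (u ⇨ x) ⊓ (S.restrict (u ⊔ x)).1 := by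
    refine le_antisymm (le_inf le_himp (le_sup_right.trans (S.giRestrict.gc.le_u_l _))) ?_
    have : S.restrict ((u ⇨ x) ⊓ (u ⊔ x)) ≤ ⟨x, hx⟩ := by
      rw [Theory.restrict_le_iff, inf_sup_left]
      exact sup_le himp_inf_le inf_le_right
    rw [map_inf, Sublocale.restrict_of_mem (S.himp_mem hx)] at this
    exact this
  rw [h3]
  exact Sublocale.inf_mem ((le_sup_left : _ ≤ (S ⊓ openSublocale u) ⊔ (S ⊓ closedSublocale u)) h1)
    ((le_sup_right : _ ≤ (S ⊓ openSublocale u) ⊔ (S ⊓ closedSublocale u)) h2)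

end Sublocale

/-- Since `⊤ ⇨ x = x`, the condition imposed by the extra axiom `⊤ → χ` is literally `χ ⇨ x ≤ x`. -/
theorem nonArch_space_eq :
    NonArch.space = (AbsVal ℤ).space ⊓ openSublocale (someSmall.eval FreeFrame.gen) := by
  refine le_antisymm (le_inf ?_ ?_) ?_
  · exact fun x hx φ ψ h => hx φ ψ (.absVal h)
  · intro x hx
    have := hx _ _ .small
    rwa [show (Formula.top : Formula (ℤ × PosRat)).eval FreeFrame.gen = ⊤ from rfl,
      top_himp] at this
  · intro x hx φ ψ h
    have h1 : x ∈ (AbsVal ℤ).space := (inf_le_left : _ ≤ (AbsVal ℤ).space) hx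
    have h2 : x ∈ openSublocale (someSmall.eval FreeFrame.gen) :=
      (inf_le_right : _ ≤ openSublocale _) hx
    cases h with
    | absVal h => exact h1 φ ψ h
    | small => exact (h2 : _ ≤ _).trans le_himp

/-- Since `⊥ ⇨ x = ⊤`, an axiom `χ → ⊥` imposes `χ ≤ x`; over all `n ≠ 0` this bounds the join. -/
theorem arch_space_eq :
    Arch.space = (AbsVal ℤ).space ⊓ closedSublocale (someSmall.eval FreeFrame.gen) := by
  have eval_bot : (Formula.bot : Formula (ℤ × PosRat)).eval FreeFrame.gen = ⊥ :=
    iSup_of_empty (α := FreeFrame (ℤ × PosRat)) (ι := Empty) _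
  refine le_antisymm (le_inf ?_ ?_) ?_
  · exact fun x hx φ ψ h => hx φ ψ (.absVal h)
  · intro x hx
    change ⨆ n : {n : ℤ // n ≠ 0}, (absLT n.1 1).eval FreeFrame.gen ≤ x
    refine iSup_le fun n => ?_
    have := hx _ _ (.one_le n.1 n.2)
    rwa [eval_bot, bot_himp, top_le_iff, himp_eq_top_iff] at this
  · intro x hx φ ψ h
    have h1 : x ∈ (AbsVal ℤ).space := (inf_le_left : _ ≤ (AbsVal ℤ).space) hx
    have h2 : x ∈ closedSublocale (someSmall.eval FreeFrame.gen) :=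
      (inf_le_right : _ ≤ closedSublocale _) hx
    cases h with
    | absVal h => exact h1 φ ψ h
    | one_le n hn =>
      rw [eval_bot, bot_himp, top_le_iff, himp_eq_top_iff]
      exact (le_iSup (fun n : {n : ℤ // n ≠ 0} => (absLT n.1 1).eval FreeFrame.gen)
        ⟨n, hn⟩).trans h2

/-! ### Countability of the theories -/

theorem UpperReal.isCountable {φ ψ : Formula ℚ} (h : UpperReal φ ψ) : ψ.IsCountable := by
  cases h
  · exact ⟨inferInstance, fun _ => trivial⟩
  · trivial

/-- The succedents of the axioms of `UpperReal`. -/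
theorem UpperReal.mem {φ ψ : Formula ℚ} (h : UpperReal φ ψ) :
    ψ ∈ Set.range (fun q : ℚ => Formula.or fun r : {r : ℚ // r < q} => .atom r.1) ∪
      Set.range (Formula.atom : ℚ → _) := by
  cases h with
  | rounded q => exact .inl ⟨q, rfl⟩
  | upward r q => exact .inr ⟨q, rfl⟩

theorem countable_upperRealNeg : UpperRealNeg.IsCountable := by
  refine ⟨Set.range (fun q : ℚ => Formula.or fun r : {r : ℚ // r < q} => .atom r.1) ∪
      Set.range (Formula.atom : ℚ → _), (Set.countable_range _).union (Set.countable_range _), ?_⟩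
  rintro φ ψ (h | _)
  · exact ⟨h.mem, h.isCountable⟩
  · exact ⟨.inr ⟨0, rfl⟩, trivial⟩

theorem countable_upperRealUnit : UpperRealUnit.IsCountable := by
  refine ⟨{.bot} ∪ (Set.range (fun q : ℚ => Formula.or fun r : {r : ℚ // r < q} => .atom r.1) ∪
      Set.range (Formula.atom : ℚ → _)),
      (Set.countable_singleton _).union
        ((Set.countable_range _).union (Set.countable_range _)), ?_⟩
  rintro φ ψ (h | _ | ⟨q, -⟩)
  · exact ⟨.inr h.mem, h.isCountable⟩
  · exact ⟨.inl rfl, Formula.isCountable_bot⟩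
  · exact ⟨.inr (.inr ⟨q, rfl⟩), trivial⟩

theorem countable_discreteTheory (P : Type) [Countable P] : (DiscreteTheory P).IsCountable := by
  refine ⟨{.or fun p : P => .atom p, .bot}, Set.to_countable _, ?_⟩
  rintro φ ψ (_ | _)
  · exact ⟨.inl rfl, inferInstance, fun _ => trivial⟩
  · exact ⟨.inr rfl, Formula.isCountable_bot⟩

theorem Theory.IsCountable.prod {G H : Type} {S : Theory G} {T : Theory H} (hS : S.IsCountable)
    (hT : T.IsCountable) : (S.prod T).IsCountable := by
  obtain ⟨A, hA, hSA⟩ := hS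
  obtain ⟨B, hB, hTB⟩ := hT
  refine ⟨Formula.map Sum.inl '' A ∪ Formula.map Sum.inr '' B,
    (hA.image _).union (hB.image _), ?_⟩
  rintro φ ψ (h | h)
  · exact ⟨.inl ⟨_, (hSA _ _ h).1, rfl⟩, (hSA _ _ h).2.map⟩
  · exact ⟨.inr ⟨_, (hTB _ _ h).1, rfl⟩, (hTB _ _ h).2.map⟩

theorem Theory.IsCountable.of_insert {G : Type} {S T : Theory G} (hS : S.IsCountable) {χ : Formula G}
    (hχ : χ.IsCountable) (h : ∀ φ ψ, T φ ψ → S φ ψ ∨ ψ = χ) : T.IsCountable := by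
  obtain ⟨A, hA, hSA⟩ := hS
  refine ⟨insert χ A, hA.insert χ, fun φ ψ hT => ?_⟩
  rcases h φ ψ hT with h | rfl
  · exact ⟨.inr (hSA _ _ h).1, (hSA _ _ h).2⟩
  · exact ⟨.inl rfl, hχ⟩

theorem countable_absVal (R : Type) [CommRing R] [Countable R] : (AbsVal R).IsCountable := by
  refine ⟨(Set.range fun i : R × PosRat => .or fun r : {r : PosRat // r < i.2} => absLT i.1 r.1) ∪
    (Set.range fun x : R => .or fun q : PosRat => absLT x q) ∪
    (Set.range fun i : R × R × PosRat => .or fun j : {j : PosRat × PosRat // j.1 * j.2 ≤ i.2.2} =>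
          .and (absLT i.1 j.1.1) (absLT i.2.1 j.1.2)) ∪
    Set.range (Formula.atom : R × PosRat → _) ∪ {.bot}, ?_, ?_⟩
  · simp only [Set.countable_union, Set.countable_range, Set.countable_singleton, and_self]
  · rintro φ ψ (⟨x, q⟩ | ⟨x, r, q⟩ | x | q | q | q | ⟨x, y, r, s⟩ | ⟨x, y, q⟩ | ⟨x, y, r, s⟩)
    · exact ⟨.inl <| .inl <| .inl <| .inl ⟨(x, q), rfl⟩, inferInstance, fun _ => trivial⟩
    · exact ⟨.inl <| .inr ⟨_, rfl⟩, trivial⟩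
    · exact ⟨.inl <| .inl <| .inl <| .inr ⟨x, rfl⟩, inferInstance, fun _ => trivial⟩
    · exact ⟨.inl <| .inr ⟨_, rfl⟩, trivial⟩
    · exact ⟨.inr rfl, Formula.isCountable_bot⟩
    · exact ⟨.inl <| .inr ⟨_, rfl⟩, trivial⟩
    · exact ⟨.inl <| .inr ⟨_, rfl⟩, trivial⟩
    · exact ⟨.inl <| .inl <| .inr ⟨(x, y, q), rfl⟩, inferInstance, fun _ => ⟨trivial, trivial⟩⟩
    · exact ⟨.inl <| .inr ⟨_, rfl⟩, trivial⟩

theorem countable_nonArch : NonArch.IsCountable := by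
  refine (countable_absVal ℤ).of_insert (χ := someSmall) ⟨inferInstance, fun _ => trivial⟩ ?_
  rintro φ ψ (h | _)
  exacts [.inl h, .inr rfl]

theorem countable_arch : Arch.IsCountable := by
  refine (countable_absVal ℤ).of_insert Formula.isCountable_bot ?_
  rintro φ ψ (h | _)
  exacts [.inl h, .inr rfl]

/-! ### Classification of multiplicative seminorms on the integers -/

/-- Multiplicative seminorms on a commutative ring, that is, absolute values that may vanish on
non-zero elements. -/
structure IsMulSeminorm {R : Type} [CommRing R] (N : R → ℝ) : Prop where
  nonneg (x : R) : 0 ≤ N x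
  zero : N 0 = 0
  one : N 1 = 1
  mul (x y : R) : N (x * y) = N x * N y
  add_le (x y : R) : N (x + y) ≤ N x + N y

namespace IsMulSeminorm

variable {R : Type} [CommRing R] {N : R → ℝ}

theorem pow (hN : IsMulSeminorm N) (x : R) (k : ℕ) : N (x ^ k) = N x ^ k := by
  induction k with
  | zero => simp [hN.one]
  | succ k ih => rw [pow_succ, pow_succ, hN.mul, ih]

theorem neg (hN : IsMulSeminorm N) (x : R) : N (-x) = N x := by
  have h : N (-1) = 1 := by
    have := hN.mul (-1) (-1)
    rw [neg_mul_neg, one_mul, hN.one] at this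
    nlinarith [hN.nonneg (-1)]
  rw [← neg_one_mul, hN.mul, h, one_mul]

theorem natCast_le (hN : IsMulSeminorm N) (n : ℕ) : N n ≤ n := by
  induction n with
  | zero => simp [hN.zero]
  | succ k ih =>
    push_cast
    exact (hN.add_le _ _).trans (by rw [hN.one]; linarith)

end IsMulSeminorm

namespace IsMulSeminorm

variable {N : ℤ → ℝ}

theorem natAbs (hN : IsMulSeminorm N) (n : ℤ) : N n.natAbs = N n := by
  rcases Int.natAbs_eq n with h | h
  · rw [← h]
  · conv_rhs => rw [h]
    rw [hN.neg]

/-- Expansion in base `p` bounds `N` on all integers by a geometric series. A bounded multiplicative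
function cannot exceed 1, because powers of a value above 1 are unbounded. -/
theorem le_one_of_lt_one (hN : IsMulSeminorm N) {p : ℕ} (hp : 0 < p) (hlt : N p < 1) (n : ℤ) :
    N n ≤ 1 := by
  -- The bound is the fixed point of `C = N p * C + p`, matching the division `m = p * (m / p) + m %
  -- p`.
  have hC (m : ℕ) : N m ≤ p / (1 - N p) := by
    induction m using Nat.strong_induction_on with
    | _ m ih =>
      have h1 : 0 < 1 - N p := by linarith
      rcases Nat.lt_or_ge m p with hm | hm
      · refine (hN.natCast_le m).trans ?_
        rw [le_div_iff₀ h1]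
        have : (m : ℝ) ≤ p := by exact_mod_cast hm.le
        nlinarith [hN.nonneg p, (Nat.cast_nonneg m : (0 : ℝ) ≤ m)]
      · have hp1 : 1 < p := by
          rcases Nat.lt_or_ge 1 p with h | h
          · exact h
          · obtain rfl : p = 1 := by omega
            simp [hN.one] at hlt
        have hdm : (m : ℤ) = p * (m / p : ℕ) + (m % p : ℕ) := by
          exact_mod_cast (Nat.div_add_mod m p).symm
        have h2 := ih (m / p) (Nat.div_lt_self (by omega) hp1)
        have h3 := (hN.natCast_le (m % p)).trans
          (show ((m % p : ℕ) : ℝ) ≤ p by exact_mod_cast (Nat.mod_lt m hp).le)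
        have h4 := hN.add_le (p * (m / p : ℕ)) (m % p : ℕ)
        rw [← hdm, hN.mul] at h4
        have h5 := mul_le_mul_of_nonneg_left h2 (hN.nonneg p)
        have h6 : N p * (p / (1 - N p)) + p = p / (1 - N p) := by
          field_simp
          ring
        linarith
  by_contra! hn
  obtain ⟨k, hk⟩ := pow_unbounded_of_one_lt (p / (1 - N p)) hn
  have := hC (n ^ k).natAbs
  rw [hN.natAbs, hN.pow] at this
  linarith

-- If `N n < 1` as well, a Bézout relation between high powers of `p` and `n`, whose coefficients
-- have value at most 1, would give `N 1 < 1`.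
open Filter Topology in
theorem eq_one_of_isCoprime (hN : IsMulSeminorm N) {p : ℕ} (hp : 0 < p) (hlt : N p < 1) {n : ℤ}
    (hn : IsCoprime (p : ℤ) n) : N n = 1 := by
  refine le_antisymm (hN.le_one_of_lt_one hp hlt n) ?_
  by_contra! h
  have ht (x : ℤ) (hx : N x < 1) : ∀ᶠ k : ℕ in atTop, N x ^ k < 1 / 2 :=
    (tendsto_pow_atTop_nhds_zero_of_lt_one (hN.nonneg x) hx).eventually_lt_const (by norm_num)
  obtain ⟨k, hk, hk'⟩ := ((ht p hlt).and (ht n h)).exists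
  obtain ⟨a, b, hab⟩ : IsCoprime ((p : ℤ) ^ k) (n ^ k) := hn.pow
  have h1 := hN.add_le (a * p ^ k) (b * n ^ k)
  rw [hab, hN.one, hN.mul, hN.mul, hN.pow, hN.pow] at h1
  have h2 := mul_le_of_le_one_left (pow_nonneg (hN.nonneg p) k) (hN.le_one_of_lt_one hp hlt a)
  have h3 := mul_le_of_le_one_left (pow_nonneg (hN.nonneg n) k) (hN.le_one_of_lt_one hp hlt b)
  linarith

theorem exists_prime_lt_one (hN : IsMulSeminorm N) {n : ℤ} (hn : n ≠ 0) (hlt : N n < 1) :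
    ∃ p : Nat.Primes, N (p : ℕ) < 1 := by
  by_contra! h
  have key (m : ℕ) (hm : m ≠ 0) : 1 ≤ N m := by
    induction m using Nat.recOnMul with
    | zero => exact (hm rfl).elim
    | one => simp [hN.one]
    | prime p hp => exact h ⟨p, hp⟩
    | mul a b iha ihb =>
      push_cast
      rw [hN.mul]
      exact one_le_mul_of_one_le_of_one_le (iha (left_ne_zero_of_mul hm))
        (ihb (right_ne_zero_of_mul hm))
  have := key n.natAbs (Int.natAbs_ne_zero.2 hn)
  rw [hN.natAbs] at this
  linarith

theorem eq_pow_padicValInt (hN : IsMulSeminorm N) {p : ℕ} (hp : p.Prime) (hlt : N p < 1) {n : ℤ}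
    (hn : n ≠ 0) : N n = N p ^ padicValInt p n := by
  obtain ⟨k, m, hpm, hk⟩ := Nat.exists_eq_pow_mul_and_not_dvd (Int.natAbs_ne_zero.2 hn) p hp.ne_one
  have := Fact.mk hp
  have hm : m ≠ 0 := fun h0 => hpm (h0 ▸ dvd_zero p)
  have hv : padicValInt p n = k := by
    rw [padicValInt, hk, padicValNat.mul (pow_ne_zero _ hp.ne_zero) hm, padicValNat.prime_pow,
      padicValNat.eq_zero_of_not_dvd hpm, add_zero]
  have hcop : IsCoprime (p : ℤ) m := Nat.isCoprime_iff_coprime.2 ((hp.coprime_iff_not_dvd).2 hpm)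
  rw [hv, ← hN.natAbs, hk, Nat.cast_mul, Nat.cast_pow, hN.mul, hN.pow,
    hN.eq_one_of_isCoprime hp.pos hlt hcop, mul_one]

/-- The extension of a multiplicative norm on the integers to the rationals. -/
theorem exists_absoluteValue (hN : IsMulSeminorm N) (hpos : ∀ n ≠ 0, 0 < N n) :
    ∃ f : AbsoluteValue ℚ ℝ, ∀ n : ℤ, f n = N n := by
  have key (a b c d : ℤ) (hb : b ≠ 0) (hd : d ≠ 0) (h : (a / b : ℚ) = c / d) :
      N a / N b = N c / N d := by
    rw [div_eq_div_iff (by exact_mod_cast hb) (by exact_mod_cast hd)] at h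
    rw [div_eq_div_iff (hpos b hb).ne' (hpos d hd).ne', ← hN.mul, ← hN.mul]
    exact congrArg N (by exact_mod_cast h)
  have hden (x : ℚ) : (x.den : ℤ) ≠ 0 := by exact_mod_cast x.den_ne_zero
  have hdpos (x : ℚ) : 0 < N x.den := hpos _ (hden x)
  have hnd (x : ℚ) : ((x.num : ℤ) : ℚ) / ((x.den : ℤ) : ℚ) = x := by
    simpa using Rat.num_div_den x
  refine ⟨⟨⟨fun x => N x.num / N x.den, fun x y => ?_⟩, fun x => ?_, fun x => ?_, fun x y => ?_⟩,
    fun n => ?_⟩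
  · rw [key (x * y).num (x * y).den (x.num * y.num) (x.den * y.den) (hden _)
      (mul_ne_zero (hden x) (hden y)) ?_, hN.mul, hN.mul, mul_div_mul_comm]
    rw [hnd]
    push_cast
    rw [mul_div_mul_comm, Rat.num_div_den, Rat.num_div_den]
  · exact div_nonneg (hN.nonneg _) (hN.nonneg _)
  · change N x.num / N x.den = 0 ↔ x = 0
    rw [div_eq_zero_iff, or_iff_left (hdpos x).ne']
    refine ⟨fun h => ?_, fun h => by simp [h, hN.zero]⟩
    by_contra hx
    exact (hpos _ (Rat.num_ne_zero.2 hx)).ne' h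
  · change N (x + y).num / N (x + y).den ≤ N x.num / N x.den + N y.num / N y.den
    rw [key (x + y).num (x + y).den (x.num * y.den + x.den * y.num) (x.den * y.den) (hden _)
      (mul_ne_zero (hden x) (hden y)) ?_, div_add_div _ _ (hdpos x).ne' (hdpos y).ne', hN.mul]
    · gcongr
      · exact mul_nonneg (hdpos x).le (hdpos y).le
      · rw [← hN.mul, ← hN.mul]
        exact hN.add_le _ _
    · rw [hnd]
      push_cast
      rw [← div_add_div _ _ (by exact_mod_cast hden x) (by exact_mod_cast hden y),
        Rat.num_div_den, Rat.num_div_den]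
  · change N (n : ℚ).num / N (n : ℚ).den = N n
    simp [hN.one]

/-- If the extension to `ℚ` is bounded by 1 on the naturals, then `N` is trivial and `l = 0`.
Otherwise Ostrowski's theorem makes it equivalent to the real absolute value, and `N 2 ≤ 2` forces
`l ≤ 1`. -/
theorem eq_rpow_of_one_le (hN : IsMulSeminorm N) (h1 : ∀ n ≠ 0, 1 ≤ N n) :
    ∃ l : ℝ, 0 ≤ l ∧ l ≤ 1 ∧ ∀ n ≠ 0, N n = (n.natAbs : ℝ) ^ l := by
  obtain ⟨f, hf⟩ := hN.exists_absoluteValue fun n hn => one_pos.trans_le (h1 n hn)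
  by_cases hb : ∀ n : ℕ, f n ≤ 1
  · refine ⟨0, le_rfl, zero_le_one, fun n hn => ?_⟩
    rw [Real.rpow_zero, ← hN.natAbs, ← hf]
    refine le_antisymm (hb n.natAbs) ?_
    rw [hf]
    exact h1 _ (by exact_mod_cast Int.natAbs_ne_zero.2 hn)
  · obtain ⟨c, hc, h⟩ := Rat.AbsoluteValue.exists_nat_rpow_iff_isEquiv.2
      (Rat.AbsoluteValue.equiv_real_of_unbounded hb)
    have hval (n : ℕ) : N n = (n : ℝ) ^ c⁻¹ := by
      have h2 := h n
      simp only [Rat.AbsoluteValue.real_eq_abs, Rat.cast_natCast, Nat.abs_cast] at h2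
      rw [← h2, Real.rpow_rpow_inv (f.nonneg _) hc.ne', ← hf]
      norm_cast
    refine ⟨c⁻¹, (inv_pos.2 hc).le, ?_, fun n hn => by rw [← hN.natAbs, hval]⟩
    have h2 := hN.natCast_le 2
    rw [hval, Nat.cast_ofNat] at h2
    rwa [← Real.rpow_le_rpow_left_iff (x := 2) one_lt_two, Real.rpow_one]

end IsMulSeminorm

/-- The case `t = 0` is included: with `0 ^ 0 = 1` it is the seminorm that vanishes exactly on the
multiples of `p`. -/
theorem isMulSeminorm_padic {p : ℕ} (hp : p.Prime) {t : ℝ} (ht : 0 ≤ t) (ht1 : t ≤ 1) :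
    IsMulSeminorm fun n : ℤ => if n = 0 then 0 else t ^ padicValInt p n := by
  have := Fact.mk hp
  refine ⟨fun n => by positivity, if_pos rfl, by simp, fun x y => ?_, fun x y => ?_⟩
  · by_cases hx : x = 0
    · simp [hx]
    by_cases hy : y = 0
    · simp [hy]
    simp only [mul_eq_zero, hx, hy, or_self, if_false]
    rw [padicValInt.mul hx hy, pow_add]
  · by_cases hx : x = 0
    · simp [hx]
    by_cases hy : y = 0
    · simp [hy]
    by_cases hxy : x + y = 0
    · simp only [hx, hy, hxy, if_true, if_false]
      positivity
    simp only [hx, hy, hxy, if_false]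
    have hmin : min (padicValInt p x) (padicValInt p y) ≤ padicValInt p (x + y) := by
      have := padicValRat.min_le_padicValRat_add (p := p) (q := x) (r := y)
        (by exact_mod_cast hxy)
      rw [← Int.cast_add, padicValRat.of_int, padicValRat.of_int, padicValRat.of_int] at this
      exact_mod_cast this
    refine (pow_le_pow_of_le_one ht ht1 hmin).trans ?_
    rcases min_choice (padicValInt p x) (padicValInt p y) with h | h <;> rw [h]
    · exact le_add_of_nonneg_right (by positivity)
    · exact le_add_of_nonneg_left (by positivity)

theorem isMulSeminorm_rpow {l : ℝ} (hl : 0 ≤ l) (hl1 : l ≤ 1) :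
    IsMulSeminorm fun n : ℤ => if n = 0 then 0 else (n.natAbs : ℝ) ^ l := by
  refine ⟨fun n => by positivity, if_pos rfl, by simp, fun x y => ?_, fun x y => ?_⟩
  · by_cases hx : x = 0
    · simp [hx]
    by_cases hy : y = 0
    · simp [hy]
    simp only [mul_eq_zero, hx, hy, or_self, if_false]
    rw [Int.natAbs_mul, Nat.cast_mul, Real.mul_rpow (Nat.cast_nonneg _) (Nat.cast_nonneg _)]
  · by_cases hx : x = 0
    · simp [hx]
    by_cases hy : y = 0
    · simp [hy]
    by_cases hxy : x + y = 0
    · simp only [hx, hy, hxy, if_true, if_false]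
      positivity
    simp only [hx, hy, hxy, if_false]
    calc ((x + y).natAbs : ℝ) ^ l ≤ (x.natAbs + y.natAbs : ℝ) ^ l := by
          gcongr
          exact_mod_cast Int.natAbs_add_le x y
      _ ≤ _ := Real.rpow_add_le_add_rpow (Nat.cast_nonneg _) (Nat.cast_nonneg _) hl hl1

/-! ### Models of upper reals and of absolute values -/

theorem upperReal_isModel_iff (U : ℚ → Prop) :
    UpperReal.IsModel U ↔ (∀ q, U q → ∃ r < q, U r) ∧ ∀ r q, r < q → U r → U q := by
  constructor
  · refine fun h => ⟨fun q hq => ?_, fun r q hrq hr => h _ _ (.upward r q hrq) hr⟩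
    simpa using h _ _ (.rounded q) hq
  · rintro ⟨h1, h2⟩ φ ψ (q | ⟨r, q, hrq⟩) h
    · simpa using h1 q h
    · exact h2 r q hrq h

/-- A non-empty rounded upper set of rationals that is bounded below is given by a real number. -/
theorem UpperReal.exists_real {U : ℚ → Prop} (hU : UpperReal.IsModel U) {m : ℝ}
    (hne : ∃ q, U q) (hm : ∀ q, U q → m ≤ q) :
    ∃ a : ℝ, m ≤ a ∧ ∀ q, U q ↔ a < q := by
  obtain ⟨hr, hu⟩ := (upperReal_isModel_iff U).1 hU
  have hne' : {x : ℝ | ∃ q : ℚ, U q ∧ (q : ℝ) = x}.Nonempty := by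
    obtain ⟨q, hq⟩ := hne
    exact ⟨q, q, hq, rfl⟩
  have hb : m ∈ lowerBounds {x : ℝ | ∃ q : ℚ, U q ∧ (q : ℝ) = x} := by
    rintro _ ⟨q, hq, rfl⟩
    exact hm q hq
  refine ⟨sInf {x : ℝ | ∃ q : ℚ, U q ∧ (q : ℝ) = x}, le_csInf hne' hb, fun q => ⟨fun hq => ?_,
    fun hq => ?_⟩⟩
  · obtain ⟨r, hrq, hr⟩ := hr q hq
    exact (csInf_le ⟨m, hb⟩ ⟨r, hr, rfl⟩).trans_lt (by exact_mod_cast hrq)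
  · obtain ⟨_, ⟨r, hr, rfl⟩, hrq⟩ := exists_lt_of_csInf_lt hne' hq
    exact hu r q (by exact_mod_cast hrq) hr

theorem UpperReal.isModel_lt (a : ℝ) : UpperReal.IsModel fun q : ℚ => a < q := by
  refine (upperReal_isModel_iff _).2 ⟨fun q hq => ?_, fun r q hrq hr => ?_⟩
  · obtain ⟨r, h1, h2⟩ := exists_rat_btwn hq
    exact ⟨r, by exact_mod_cast h2, h1⟩
  · exact hr.trans (by exact_mod_cast hrq)

@[simp] theorem eval_absLT {R : Type} (v : R × PosRat → Prop) (x : R) (q : PosRat) :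
    (absLT x q).eval v ↔ v (x, q) := Iff.rfl

theorem le_mul_of_forall_rat_lt {a b c : ℝ} (h : ∀ r s : ℚ, b < r → c < s → a ≤ r * s)
    (hb : 0 ≤ b) (hc : 0 ≤ c) : a ≤ b * c := by
  refine le_mul_of_forall_lt₀ fun b' hb' c' hc' => ?_
  obtain ⟨r, hr, hr'⟩ := exists_rat_btwn hb'
  obtain ⟨s, hs, hs'⟩ := exists_rat_btwn hc'
  exact (h r s hr hs).trans (mul_le_mul hr'.le hs'.le (hc.trans hs.le) (hb.trans (hr.trans hr').le))

section AbsVal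

variable {R : Type} [CommRing R]

theorem AbsVal.exists_real {v : R × PosRat → Prop} (hv : (AbsVal R).IsModel v) (x : R) :
    ∃ a : ℝ, 0 ≤ a ∧ ∀ q : PosRat, v (x, q) ↔ a < (q : ℚ) := by
  -- The cut on positive rationals is extended by falsity to all rationals.
  have hU : UpperReal.IsModel fun q : ℚ => ∃ h : 0 < q, v (x, ⟨q, h⟩) := by
    refine (upperReal_isModel_iff _).2 ⟨?_, ?_⟩
    · rintro q ⟨hq, hvq⟩
      obtain ⟨r, hr⟩ := (Formula.eval_or _ _).1 (hv _ _ (.rounded x ⟨q, hq⟩) hvq)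
      exact ⟨r.1.1, r.2, r.1.2, hr⟩
    · rintro r q hrq ⟨hr, hvr⟩
      exact ⟨hr.trans hrq, hv _ _ (.upward x ⟨r, hr⟩ ⟨q, hr.trans hrq⟩ hrq) hvr⟩
  obtain ⟨q, hq⟩ := (Formula.eval_or _ _).1 (hv _ _ (.finite x) trivial)
  obtain ⟨a, ha, h⟩ := UpperReal.exists_real hU (m := 0) ⟨q.1, q.2, hq⟩
    fun q hq => by exact_mod_cast hq.1.le
  exact ⟨a, ha, fun q => Iff.trans ⟨fun h => ⟨q.2, h⟩, fun ⟨_, h⟩ => h⟩ (h q.1)⟩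

/-- The models of the theory of absolute values are the multiplicative seminorms. -/
theorem absVal_isModel_iff (v : R × PosRat → Prop) : (AbsVal R).IsModel v ↔
    ∃ N : R → ℝ, IsMulSeminorm N ∧ ∀ x (q : PosRat), v (x, q) ↔ N x < (q : ℚ) := by
  constructor
  · intro hv
    choose N hN hvN using AbsVal.exists_real hv
    have lt {x : R} {q : ℚ} (h : N x < q) : ∃ hq : 0 < q, v (x, ⟨q, hq⟩) := by
      have hq : 0 < q := by exact_mod_cast (hN x).trans_lt h
      exact ⟨hq, (hvN x ⟨q, hq⟩).2 h⟩
    refine ⟨N, ⟨hN, ?_, ?_, fun x y => ?_, fun x y => ?_⟩, hvN⟩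
    · refine le_antisymm (le_of_forall_lt_rat_imp_le fun q hq => ?_) (hN 0)
      exact ((hvN 0 ⟨q, by exact_mod_cast hq⟩).1 (hv _ _ (.zero _) trivial)).le
    · refine le_antisymm (le_of_forall_lt_rat_imp_le fun q hq => ?_) ?_
      · have hq1 : 1 < q := by exact_mod_cast hq
        exact ((hvN 1 ⟨q, one_pos.trans hq1⟩).1 (hv _ _ (.le_one _ hq1) trivial)).le
      · by_contra! h
        obtain ⟨q, hq, hq1⟩ := exists_rat_btwn h
        obtain ⟨hq0, hvq⟩ := lt hq
        have hq1' : q ≤ 1 := by exact_mod_cast hq1.le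
        exact Formula.eval_bot _ (hv _ _ (.one_le ⟨q, hq0⟩ hq1') hvq)
    · refine le_antisymm (le_mul_of_forall_rat_lt (fun r s hr hs => ?_) (hN x) (hN y))
        (le_of_forall_lt_rat_imp_le fun q hq => ?_)
      · obtain ⟨hr0, hvr⟩ := lt hr
        obtain ⟨hs0, hvs⟩ := lt hs
        have := (hvN _ _).1 (hv _ _ (.mul_le x y ⟨r, hr0⟩ ⟨s, hs0⟩) ⟨hvr, hvs⟩)
        exact_mod_cast this.le
      · obtain ⟨hq0, hvq⟩ := lt hq
        obtain ⟨⟨⟨r, s⟩, hrs⟩, hr, hs⟩ :=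
          (Formula.eval_or _ _).1 (hv _ _ (.le_mul x y ⟨q, hq0⟩) hvq)
        have hrs' : ((r.1 : ℝ) * (s.1 : ℝ)) ≤ q := by exact_mod_cast (show r.1 * s.1 ≤ q from hrs)
        exact (mul_le_mul ((hvN _ _).1 hr).le ((hvN _ _).1 hs).le (hN y)
          (by exact_mod_cast r.2.le)).trans hrs'
    · by_contra! h
      obtain ⟨r, hr, hr'⟩ := exists_rat_btwn
        (show N x < N x + (N (x + y) - (N x + N y)) / 2 by linarith)
      obtain ⟨s, hs, hs'⟩ := exists_rat_btwn
        (show N y < N y + (N (x + y) - (N x + N y)) / 2 by linarith)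
      obtain ⟨hr0, hvr⟩ := lt hr
      obtain ⟨hs0, hvs⟩ := lt hs
      have := (hvN _ _).1 (hv _ _ (.add x y ⟨r, hr0⟩ ⟨s, hs0⟩) ⟨hvr, hvs⟩)
      have h' : N (x + y) < r + s := by exact_mod_cast this
      linarith
  · rintro ⟨N, hN, hv⟩ φ ψ
      (⟨x, q⟩ | ⟨x, r, q, h⟩ | x | q | ⟨q, h⟩ | ⟨q, h⟩ | ⟨x, y, r, s⟩ | ⟨x, y, q⟩ | ⟨x, y, r, s⟩)
    all_goals simp only [eval_absLT, Formula.eval_or, Formula.eval_and, Formula.eval_top, hv,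
      forall_true_left]
    · intro h
      obtain ⟨r, h1, h2⟩ := exists_rat_btwn h
      exact ⟨⟨⟨r, by exact_mod_cast (hN.nonneg x).trans_lt h1⟩, by exact_mod_cast h2⟩, h1⟩
    · exact fun h' => h'.trans (by exact_mod_cast h)
    · obtain ⟨q, hq⟩ := exists_rat_gt (N x)
      exact ⟨⟨q, by exact_mod_cast (hN.nonneg x).trans_lt hq⟩, hq⟩
    · rw [hN.zero]
      exact_mod_cast q.2
    · rw [hN.one]
      intro h'
      have : (1 : ℚ) < q.1 := by exact_mod_cast h'
      exact absurd h (not_le.2 this)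
    · rw [hN.one]
      exact_mod_cast h
    · rintro ⟨h1, h2⟩
      rw [hN.mul]
      exact_mod_cast mul_lt_mul'' h1 h2 (hN.nonneg x) (hN.nonneg y)
    · intro h
      -- If no rationals `r > N x` and `s > N y` had `r * s ≤ q`, all such products would exceed
      -- `q`, giving `q ≤ N x * N y`.
      by_contra! hn
      refine h.not_ge ?_
      rw [hN.mul]
      refine le_mul_of_forall_rat_lt (fun r s hr hs => ?_) (hN.nonneg x) (hN.nonneg y)
      by_contra! hlt
      have hr0 : 0 < r := by exact_mod_cast (hN.nonneg x).trans_lt hr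
      have hs0 : 0 < s := by exact_mod_cast (hN.nonneg y).trans_lt hs
      have hle : (⟨r, hr0⟩ : PosRat) * ⟨s, hs0⟩ ≤ q := by
        change r * s ≤ q.1
        exact_mod_cast hlt.le
      exact (hn ⟨(⟨r, hr0⟩, ⟨s, hs0⟩), hle⟩ hr).not_gt hs
    · rintro ⟨h1, h2⟩
      have := (hN.add_le x y).trans_lt (add_lt_add h1 h2)
      exact_mod_cast this

end AbsVal

/-! ### Non-Archimedean absolute values -/

/-- The seminorm on the integers with `|n| = t ^ ord_p n` for `n ≠ 0`. -/
noncomputable def padicSeminorm (p : ℕ) (t : ℝ) (n : ℤ) : ℝ :=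
  if n = 0 then 0 else t ^ padicValInt p n

theorem nonArch_isModel_iff (w : ℤ × PosRat → Prop) : NonArch.IsModel w ↔
    ∃ (p : Nat.Primes) (t : ℝ), 0 ≤ t ∧ t < 1 ∧
      ∀ n (q : PosRat), w (n, q) ↔ padicSeminorm p t n < (q : ℚ) := by
  have key : NonArch.IsModel w ↔ (AbsVal ℤ).IsModel w ∧ ∃ n ≠ 0, w (n, 1) := by
    constructor
    · refine fun h => ⟨fun φ ψ hφ => h φ ψ (.absVal hφ), ?_⟩
      obtain ⟨n, hn⟩ := (Formula.eval_or _ _).1 (h _ _ .small trivial)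
      exact ⟨n.1, n.2, hn⟩
    · rintro ⟨h, n, hn, hw⟩ φ ψ (hφ | _)
      · exact h φ ψ hφ
      · exact fun _ => (Formula.eval_or _ _).2 ⟨⟨n, hn⟩, hw⟩
  rw [key, absVal_isModel_iff]
  constructor
  · rintro ⟨⟨N, hN, hw⟩, n, hn, hn1⟩
    obtain ⟨p, hp⟩ := hN.exists_prime_lt_one hn (by simpa using (hw n 1).1 hn1)
    refine ⟨p, N (p : ℕ), hN.nonneg _, hp, fun m q => ?_⟩
    rw [hw, padicSeminorm]
    split_ifs with hm
    · rw [hm, hN.zero]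
    · rw [hN.eq_pow_padicValInt p.2 hp hm]
  · rintro ⟨p, t, ht, ht1, hw⟩
    refine ⟨⟨_, isMulSeminorm_padic p.2 ht ht1.le, hw⟩, (p : ℕ),
      by exact_mod_cast p.2.ne_zero, (hw _ _).2 ?_⟩
    have := Fact.mk p.2
    rw [padicSeminorm, if_neg (by exact_mod_cast p.2.ne_zero), padicValInt.self p.2.one_lt]
    simpa using ht1

theorem prod_isModel_iff {G H : Type} (S : Theory G) (T : Theory H) (v : G ⊕ H → Prop) :
    (S.prod T).IsModel v ↔
      (S.IsModel fun g => v (.inl g)) ∧ T.IsModel fun h => v (.inr h) := by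
  constructor
  · intro hv
    refine ⟨fun φ ψ h => ?_, fun φ ψ h => ?_⟩
    · have := hv _ _ (.fst h)
      rwa [Formula.eval_map, Formula.eval_map] at this
    · have := hv _ _ (.snd h)
      rwa [Formula.eval_map, Formula.eval_map] at this
  · rintro ⟨h1, h2⟩ _ _ (h | h)
    · rw [Formula.eval_map, Formula.eval_map]
      exact h1 _ _ h
    · rw [Formula.eval_map, Formula.eval_map]
      exact h2 _ _ h

theorem discreteTheory_isModel_iff {P : Type} (v : P → Prop) :
    (DiscreteTheory P).IsModel v ↔ ∃ p, ∀ p', v p' ↔ p' = p := by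
  constructor
  · intro hv
    obtain ⟨p, hp⟩ := (Formula.eval_or _ _).1 (hv _ _ .exists_eq trivial)
    refine ⟨p, fun p' => ⟨fun hp' => ?_, fun h => h ▸ hp⟩⟩
    by_contra hne
    exact Formula.eval_bot _ (hv _ _ (.unique p' p hne) ⟨hp', hp⟩)
  · rintro ⟨p, hp⟩ φ ψ (_ | ⟨p₁, p₂, hne⟩)
    · exact fun _ => (Formula.eval_or _ _).2 ⟨p, (hp p).2 rfl⟩
    · rintro ⟨h1, h2⟩
      exact (hne (((hp p₁).1 h1).trans ((hp p₂).1 h2).symm)).elim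

open Topology in
theorem exists_rat_lt_rpow_lt {b t : ℝ} (hb : 0 < b) {r : ℝ} (h : t < b ^ r) :
    ∃ s : ℚ, (s : ℝ) < r ∧ t < b ^ (s : ℝ) := by
  have h1 : ∀ᶠ s in 𝓝[<] r, t < b ^ s :=
    ((Real.continuous_const_rpow hb.ne').tendsto r).eventually_const_lt h |>.filter_mono
      nhdsWithin_le_nhds
  obtain ⟨l, hl, hlr⟩ := (mem_nhdsLT_iff_exists_Ioo_subset).1 h1
  obtain ⟨s, hs, hs'⟩ := exists_rat_btwn (Set.mem_Iio.1 hl)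
  exact ⟨s, hs', hlr ⟨hs, hs'⟩⟩

open Topology in
theorem exists_rat_gt_rpow_lt {b t : ℝ} (hb : 0 < b) {r : ℝ} (h : b ^ r < t) :
    ∃ s : ℚ, r < s ∧ b ^ (s : ℝ) < t := by
  have h1 : ∀ᶠ s in 𝓝[>] r, b ^ s < t :=
    ((Real.continuous_const_rpow hb.ne').tendsto r).eventually_lt_const h |>.filter_mono
      nhdsWithin_le_nhds
  obtain ⟨l, hl, hlr⟩ := (mem_nhdsGT_iff_exists_Ioo_subset).1 h1
  obtain ⟨s, hs, hs'⟩ := exists_rat_btwn (Set.mem_Ioi.1 hl)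
  exact ⟨s, hs, hlr ⟨hs, hs'⟩⟩

/-- The exponential `r ↦ b ^ r` turns exponents in `[-∞, 0)` into reals `t` in `[0, 1)`, so that
`-∞` becomes `t = 0` and needs no separate case. -/
theorem upperRealNeg_isModel_iff {b : ℝ} (hb : 1 < b) (v : ℚ → Prop) :
    UpperRealNeg.IsModel v ↔ ∃ t : ℝ, 0 ≤ t ∧ t < 1 ∧ ∀ r : ℚ, v r ↔ t < b ^ (r : ℝ) := by
  have key : UpperRealNeg.IsModel v ↔ UpperReal.IsModel v ∧ v 0 := by
    constructor
    · exact fun h => ⟨fun φ ψ hφ => h φ ψ (.upperReal hφ), h _ _ .lt_zero trivial⟩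
    · rintro ⟨h, h0⟩ φ ψ (hφ | _)
      exacts [h φ ψ hφ, fun _ => h0]
  rw [key, upperReal_isModel_iff]
  have hb0 : 0 < b := one_pos.trans hb
  constructor
  · rintro ⟨⟨h1, h2⟩, h0⟩
    set A : Set ℝ := {x | ∃ r : ℚ, v r ∧ b ^ (r : ℝ) = x} with hA
    have hne : A.Nonempty := ⟨_, 0, h0, rfl⟩
    have hbd : 0 ∈ lowerBounds A := by
      rintro _ ⟨r, -, rfl⟩
      positivity
    have key (r : ℚ) : v r ↔ sInf A < b ^ (r : ℝ) := by
      constructor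
      · intro hr
        obtain ⟨s, hsr, hs⟩ := h1 r hr
        exact (csInf_le ⟨0, hbd⟩ ⟨s, hs, rfl⟩).trans_lt
          (Real.rpow_lt_rpow_of_exponent_lt hb (by exact_mod_cast hsr))
      · intro hr
        obtain ⟨_, ⟨s, hs, rfl⟩, hsr⟩ := exists_lt_of_csInf_lt hne hr
        exact h2 s r (by exact_mod_cast (Real.rpow_lt_rpow_left_iff hb).1 hsr) hs
    exact ⟨sInf A, le_csInf hne hbd, by simpa using (key 0).1 h0, key⟩
  · rintro ⟨t, ht, ht1, h⟩
    refine ⟨⟨fun q hq => ?_, fun r q hrq hr => ?_⟩, (h 0).2 (by simpa using ht1)⟩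
    · obtain ⟨s, hs, hs'⟩ := exists_rat_lt_rpow_lt hb0 ((h q).1 hq)
      exact ⟨s, by exact_mod_cast hs, (h s).2 hs'⟩
    · exact (h q).2 (((h r).1 hr).trans
        (Real.rpow_lt_rpow_of_exponent_lt hb (by exact_mod_cast hrq)))

theorem primes_prod_isModel_iff (v : Nat.Primes ⊕ ℚ → Prop) :
    ((DiscreteTheory Nat.Primes).prod UpperRealNeg).IsModel v ↔
      ∃ (p : Nat.Primes) (t : ℝ), 0 ≤ t ∧ t < 1 ∧ (∀ p', v (.inl p') ↔ p' = p) ∧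
        ∀ r : ℚ, v (.inr r) ↔ t < ((p : ℕ) : ℝ) ^ (r : ℝ) := by
  have hp1 (p : Nat.Primes) : (1 : ℝ) < (p : ℕ) := by exact_mod_cast p.2.one_lt
  rw [prod_isModel_iff, discreteTheory_isModel_iff]
  constructor
  · rintro ⟨⟨p, hp⟩, h⟩
    obtain ⟨t, ht, ht1, h⟩ := (upperRealNeg_isModel_iff (hp1 p) _).1 h
    exact ⟨p, t, ht, ht1, hp, h⟩
  · rintro ⟨p, t, ht, ht1, hp, h⟩
    exact ⟨⟨p, hp⟩, (upperRealNeg_isModel_iff (hp1 p) _).2 ⟨t, ht, ht1, h⟩⟩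

/-- The absolute value `|n| = (p ^ ord_p n) ^ l`: the formula `|n| < q` in terms of `p` and `l`. -/
def padicFormula : ℤ × PosRat → Formula (Nat.Primes ⊕ ℚ) := fun x =>
  if x.1 = 0 then .top else
    .or fun i : {i : Nat.Primes × ℚ //
        (((i.1 : ℕ) : ℝ) ^ padicValInt (i.1 : ℕ) x.1) ^ (i.2 : ℝ) < ((x.2 : ℚ) : ℝ)} =>
      .and (.atom (Sum.inl i.1.1)) (.atom (Sum.inr i.1.2))

/-- The prime `p` with `|p| < 1` and the exponent `l` with `|p| = p ^ l` of a non-Archimedean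
absolute value. -/
def primeExponentFormula : Nat.Primes ⊕ ℚ → Formula (ℤ × PosRat)
  | .inl p => absLT (p : ℕ) 1
  | .inr r => .or fun i : {i : Nat.Primes × PosRat //
      ((i.2 : ℚ) : ℝ) ≤ ((i.1 : ℕ) : ℝ) ^ (r : ℝ)} =>
        .and (absLT (i.1.1 : ℕ) 1) (absLT (i.1.1 : ℕ) i.1.2)

open Topology in
theorem eval_padicFormula {v : Nat.Primes ⊕ ℚ → Prop} {p : Nat.Primes} {t : ℝ} (ht : 0 ≤ t)
    (hp : ∀ p', v (.inl p') ↔ p' = p)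
    (hr : ∀ r : ℚ, v (.inr r) ↔ t < ((p : ℕ) : ℝ) ^ (r : ℝ)) (n : ℤ) (q : PosRat) :
    (padicFormula (n, q)).eval v ↔ padicSeminorm p t n < (q : ℚ) := by
  have hq : (0 : ℝ) < (q : ℚ) := by exact_mod_cast q.2
  have hp0 : (0 : ℝ) < (p : ℕ) := by exact_mod_cast p.2.pos
  by_cases hn : n = 0
  · simpa [padicFormula, padicSeminorm, hn] using hq
  simp only [padicFormula, padicSeminorm, hn, if_false, Formula.eval_or, Formula.eval_and,
    Formula.eval_atom]
  have hcomm (k : ℕ) (r : ℝ) : (((p : ℕ) : ℝ) ^ k) ^ r = (((p : ℕ) : ℝ) ^ r) ^ k := by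
    rw [← Real.rpow_natCast, ← Real.rpow_natCast, ← Real.rpow_mul hp0.le, ← Real.rpow_mul hp0.le,
      mul_comm]
  constructor
  · rintro ⟨⟨⟨p', r⟩, hi⟩, h1, h2⟩
    obtain rfl := (hp p').1 h1
    refine lt_of_le_of_lt ?_ hi
    dsimp only
    rw [hcomm]
    exact pow_le_pow_left₀ ht ((hr r).1 h2).le _
  · intro h
    suffices ∃ r : ℚ, t < ((p : ℕ) : ℝ) ^ (r : ℝ) ∧
        (((p : ℕ) : ℝ) ^ (r : ℝ)) ^ padicValInt p n < (q : ℚ) by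
      obtain ⟨r, h1, h2⟩ := this
      refine ⟨⟨(p, r), ?_⟩, (hp p).2 rfl, (hr r).2 h1⟩
      dsimp only
      rwa [hcomm]
    -- Moving from `t` to a slightly larger `x` makes the logarithm available even for `t = 0`. A
    -- rational `r` just below `log_p x` then keeps `t < p ^ r ≤ x`.
    have h1 : ∀ᶠ x : ℝ in 𝓝[>] t, x ^ padicValInt p n < (q : ℚ) :=
      ((continuous_pow _).tendsto t).eventually_lt_const h |>.filter_mono nhdsWithin_le_nhds
    obtain ⟨x, hxq, htx⟩ := (h1.and self_mem_nhdsWithin).exists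
    have hx : 0 < x := ht.trans_lt htx
    have hlog : ((p : ℕ) : ℝ) ^ Real.logb (p : ℕ) x = x :=
      Real.rpow_logb hp0 (by exact_mod_cast p.2.ne_one) hx
    obtain ⟨r, hr1, hr2⟩ := exists_rat_lt_rpow_lt hp0 (r := Real.logb (p : ℕ) x)
      (t := t) (by rwa [hlog])
    refine ⟨r, hr2, lt_of_le_of_lt (pow_le_pow_left₀ (by positivity) ?_ _) hxq⟩
    rw [← hlog]
    exact Real.rpow_le_rpow_of_exponent_le (by exact_mod_cast p.2.one_lt.le) hr1.le

theorem eval_primeExponentFormula_inl {w : ℤ × PosRat → Prop} {p : Nat.Primes} {t : ℝ}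
    (ht1 : t < 1) (hw : ∀ n (q : PosRat), w (n, q) ↔ padicSeminorm p t n < (q : ℚ))
    (p' : Nat.Primes) : (primeExponentFormula (.inl p')).eval w ↔ p' = p := by
  have := Fact.mk p.2
  have h0 : ((p' : ℕ) : ℤ) ≠ 0 := by exact_mod_cast p'.2.ne_zero
  change w _ ↔ _
  rw [hw, padicSeminorm, if_neg h0]
  constructor
  · intro h
    by_contra hne
    have : padicValInt p (p' : ℕ) = 0 := by
      rw [padicValInt, Int.natAbs_natCast]
      exact padicValNat.eq_zero_of_not_dvd fun hd =>
        hne (Subtype.ext ((Nat.prime_dvd_prime_iff_eq p.2 p'.2).1 hd).symm)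
    rw [this] at h
    simp at h
  · rintro rfl
    rw [padicValInt.self p'.2.one_lt]
    simpa using ht1

/-- The conjunct `|p'| < 1` forces `p' = p`, and `|p| = t`; a rational between `t` and `p ^ r`
serves as witness. -/
theorem eval_primeExponentFormula_inr {w : ℤ × PosRat → Prop} {p : Nat.Primes} {t : ℝ} (ht : 0 ≤ t)
    (ht1 : t < 1) (hw : ∀ n (q : PosRat), w (n, q) ↔ padicSeminorm p t n < (q : ℚ)) (r : ℚ) :
    (primeExponentFormula (.inr r)).eval w ↔ t < ((p : ℕ) : ℝ) ^ (r : ℝ) := by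
  have hinl := eval_primeExponentFormula_inl ht1 hw
  have hval (q : PosRat) : w ((p : ℕ), q) ↔ t < (q : ℚ) := by
    have := Fact.mk p.2
    rw [hw, padicSeminorm, if_neg (by exact_mod_cast p.2.ne_zero), padicValInt.self p.2.one_lt,
      pow_one]
  simp only [primeExponentFormula, Formula.eval_or, Formula.eval_and, eval_absLT]
  constructor
  · rintro ⟨⟨⟨p', q⟩, hi⟩, h1, h2⟩
    obtain rfl := (hinl p').1 h1
    exact ((hval q).1 h2).trans_le hi
  · intro h
    obtain ⟨q, h1, h2⟩ := exists_rat_btwn h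
    exact ⟨⟨(p, ⟨q, by exact_mod_cast ht.trans_lt h1⟩), h2.le⟩, (hinl p).2 rfl, (hval _).2 h1⟩

theorem exists_nonArch_orderIso :
    ∃ e : NonArch.space ≃o ((DiscreteTheory Nat.Primes).prod UpperRealNeg).space,
      ∀ x, e (NonArch.opens (.atom x)) =
        ((DiscreteTheory Nat.Primes).prod UpperRealNeg).opens (padicFormula x) := by
  refine Theory.exists_orderIso countable_nonArch
    ((countable_discreteTheory _).prod countable_upperRealNeg) padicFormula ?_
    primeExponentFormula ?_ ?_ ?_ ?_ ?_
  · intro x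
    unfold padicFormula
    split_ifs
    · trivial
    · exact ⟨inferInstance, fun _ => ⟨trivial, trivial⟩⟩
  · rintro (p | r)
    · trivial
    · exact ⟨inferInstance, fun _ => ⟨trivial, trivial⟩⟩
  · intro v hv
    obtain ⟨p, t, ht, ht1, hp, hr⟩ := (primes_prod_isModel_iff v).1 hv
    exact (nonArch_isModel_iff _).2 ⟨p, t, ht, ht1, eval_padicFormula ht hp hr⟩
  · intro w hw
    obtain ⟨p, t, ht, ht1, h⟩ := (nonArch_isModel_iff w).1 hw
    exact (primes_prod_isModel_iff _).2 ⟨p, t, ht, ht1, eval_primeExponentFormula_inl ht1 h,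
      eval_primeExponentFormula_inr ht ht1 h⟩
  · intro v hv
    obtain ⟨p, t, ht, ht1, hp, hr⟩ := (primes_prod_isModel_iff v).1 hv
    have h := eval_padicFormula ht hp hr
    rintro (p' | r)
    · rw [eval_primeExponentFormula_inl ht1 h, hp]
    · rw [eval_primeExponentFormula_inr ht ht1 h, hr]
  · intro w hw
    obtain ⟨p, t, ht, ht1, h⟩ := (nonArch_isModel_iff w).1 hw
    rintro ⟨n, q⟩
    rw [eval_padicFormula ht (eval_primeExponentFormula_inl ht1 h)
      (eval_primeExponentFormula_inr ht ht1 h), h]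

/-! ### Archimedean absolute values -/

/-- The power `|n| ^ l` of the usual absolute value, sending zero to zero. -/
noncomputable def rpowSeminorm (l : ℝ) (n : ℤ) : ℝ :=
  if n = 0 then 0 else (n.natAbs : ℝ) ^ l

theorem arch_isModel_iff (w : ℤ × PosRat → Prop) : Arch.IsModel w ↔
    ∃ l : ℝ, 0 ≤ l ∧ l ≤ 1 ∧ ∀ n (q : PosRat), w (n, q) ↔ rpowSeminorm l n < (q : ℚ) := by
  have key : Arch.IsModel w ↔ (AbsVal ℤ).IsModel w ∧ ∀ n ≠ 0, ¬ w (n, 1) := by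
    constructor
    · exact fun h => ⟨fun φ ψ hφ => h φ ψ (.absVal hφ),
        fun n hn hw => Formula.eval_bot _ (h _ _ (.one_le n hn) hw)⟩
    · rintro ⟨h, h1⟩ φ ψ (hφ | ⟨n, hn⟩)
      · exact h φ ψ hφ
      · exact fun hw => (h1 n hn hw).elim
  rw [key, absVal_isModel_iff]
  constructor
  · rintro ⟨⟨N, hN, hw⟩, h1⟩
    obtain ⟨l, hl, hl1, h⟩ := hN.eq_rpow_of_one_le fun n hn => by simpa [hw] using h1 n hn
    refine ⟨l, hl, hl1, fun m q => ?_⟩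
    rw [hw, rpowSeminorm]
    split_ifs with hm
    · rw [hm, hN.zero]
    · rw [h m hm]
  · rintro ⟨l, hl, hl1, hw⟩
    refine ⟨⟨_, isMulSeminorm_rpow hl hl1, hw⟩, fun n hn h => ?_⟩
    rw [hw, rpowSeminorm, if_neg hn] at h
    refine h.not_ge ?_
    simpa using Real.one_le_rpow
      (show (1 : ℝ) ≤ n.natAbs by exact_mod_cast Int.natAbs_pos.2 hn) hl

theorem upperRealUnit_isModel_iff (v : ℚ → Prop) : UpperRealUnit.IsModel v ↔
    ∃ l : ℝ, 0 ≤ l ∧ l ≤ 1 ∧ ∀ r : ℚ, v r ↔ l < r := by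
  have key : UpperRealUnit.IsModel v ↔ UpperReal.IsModel v ∧ ¬ v 0 ∧ ∀ q, 1 < q → v q := by
    constructor
    · exact fun h => ⟨fun φ ψ hφ => h φ ψ (.upperReal hφ),
        fun h0 => Formula.eval_bot _ (h _ _ .zero_le h0), fun q hq => h _ _ (.le_one q hq) trivial⟩
    · rintro ⟨h, h0, h1⟩ φ ψ (hφ | _ | ⟨q, hq⟩)
      exacts [h φ ψ hφ, fun hv => (h0 hv).elim, fun _ => h1 q hq]
  rw [key]
  constructor
  · rintro ⟨h, h0, h1⟩
    obtain ⟨l, hl, hv⟩ := UpperReal.exists_real h (m := 0) ⟨2, h1 2 one_lt_two⟩ fun q hq => by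
      by_contra! hq0
      exact h0 (((upperReal_isModel_iff v).1 h).2 q 0 (by exact_mod_cast hq0) hq)
    refine ⟨l, hl, le_of_forall_lt_rat_imp_le fun q hq => ?_, hv⟩
    exact ((hv q).1 (h1 q (by exact_mod_cast hq))).le
  · rintro ⟨l, hl, hl1, hv⟩
    obtain rfl : v = fun r : ℚ => l < r := funext fun r => propext (hv r)
    exact ⟨UpperReal.isModel_lt l, by simpa using hl,
      fun q hq => hl1.trans_lt (by exact_mod_cast hq)⟩

/-- The absolute value `|n| ^ l`: the formula `|n| < q` in terms of `l`. -/
def rpowFormula : ℤ × PosRat → Formula ℚ := fun x =>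
  if x.1 = 0 then .top else
    .or fun r : {r : ℚ // (x.1.natAbs : ℝ) ^ (r : ℝ) < ((x.2 : ℚ) : ℝ)} => .atom r.1

/-- The exponent `l` with `|2| = 2 ^ l` of an Archimedean absolute value. -/
def exponentFormula (r : ℚ) : Formula (ℤ × PosRat) :=
  .or fun q : {q : PosRat // ((q : ℚ) : ℝ) ≤ 2 ^ (r : ℝ)} => absLT 2 q.1

theorem eval_rpowFormula {v : ℚ → Prop} {l : ℝ} (hv : ∀ r : ℚ, v r ↔ l < r) (n : ℤ)
    (q : PosRat) : (rpowFormula (n, q)).eval v ↔ rpowSeminorm l n < (q : ℚ) := by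
  have hq : (0 : ℝ) < (q : ℚ) := by exact_mod_cast q.2
  by_cases hn : n = 0
  · simpa [rpowFormula, rpowSeminorm, hn] using hq
  have h1 : (1 : ℝ) ≤ n.natAbs := by exact_mod_cast Int.natAbs_pos.2 hn
  simp only [rpowFormula, rpowSeminorm, hn, if_false, Formula.eval_or, Formula.eval_atom, hv]
  constructor
  · rintro ⟨⟨r, hr⟩, hlr⟩
    exact (Real.rpow_le_rpow_of_exponent_le h1 hlr.le).trans_lt hr
  · intro h
    obtain ⟨r, hr, hr'⟩ := exists_rat_gt_rpow_lt (one_pos.trans_le h1) h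
    exact ⟨⟨r, hr'⟩, hr⟩

/-- The value at 2 determines the exponent, because `2 ^ l` is strictly increasing in `l`. -/
theorem eval_exponentFormula {w : ℤ × PosRat → Prop} {l : ℝ}
    (hw : ∀ n (q : PosRat), w (n, q) ↔ rpowSeminorm l n < (q : ℚ)) (r : ℚ) :
    (exponentFormula r).eval w ↔ l < r := by
  have h2 : rpowSeminorm l 2 = 2 ^ l := by simp [rpowSeminorm]
  simp only [exponentFormula, Formula.eval_or, eval_absLT, hw, h2]
  rw [← Real.rpow_lt_rpow_left_iff (one_lt_two (α := ℝ))]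
  constructor
  · rintro ⟨⟨q, hq⟩, h⟩
    exact h.trans_le hq
  · intro h
    obtain ⟨q, h1, h2⟩ := exists_rat_btwn h
    exact ⟨⟨⟨q, by exact_mod_cast (Real.rpow_pos_of_pos two_pos l).trans h1⟩, h2.le⟩, h1⟩

theorem exists_arch_orderIso :
    ∃ e : Arch.space ≃o UpperRealUnit.space,
      ∀ x, e (Arch.opens (.atom x)) = UpperRealUnit.opens (rpowFormula x) := by
  refine Theory.exists_orderIso countable_arch countable_upperRealUnit rpowFormula ?_
    exponentFormula (fun _ => ⟨inferInstance, fun _ => trivial⟩) ?_ ?_ ?_ ?_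
  · intro x
    unfold rpowFormula
    split_ifs
    · trivial
    · exact ⟨inferInstance, fun _ => trivial⟩
  · intro v hv
    obtain ⟨l, hl, hl1, h⟩ := (upperRealUnit_isModel_iff v).1 hv
    exact (arch_isModel_iff _).2 ⟨l, hl, hl1, eval_rpowFormula h⟩
  · intro w hw
    obtain ⟨l, hl, hl1, h⟩ := (arch_isModel_iff w).1 hw
    exact (upperRealUnit_isModel_iff _).2 ⟨l, hl, hl1, eval_exponentFormula h⟩
  · intro v hv r
    obtain ⟨l, hl, hl1, h⟩ := (upperRealUnit_isModel_iff v).1 hv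
    rw [eval_exponentFormula (eval_rpowFormula h), h]
  · rintro w hw ⟨n, q⟩
    obtain ⟨l, hl, hl1, h⟩ := (arch_isModel_iff w).1 hw
    rw [eval_rpowFormula (eval_exponentFormula h), h]

/-- A homeomorphism between point-free spaces is an isomorphism of their frames of opens. -/
theorem corollary4p9 :
    -- the non-Archimedean absolute values form an open subspace of the space of absolute values
    (NonArch.space =
      (AbsVal ℤ).space ⊓ openSublocale (someSmall.eval FreeFrame.gen)) ∧
    -- the Archimedean absolute values form its closed complement
    (Arch.space =
      (AbsVal ℤ).space ⊓ closedSublocale (someSmall.eval FreeFrame.gen)) ∧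
    NonArch.space ⊔ Arch.space = (AbsVal ℤ).space ∧
    NonArch.space ⊓ Arch.space = ⊥ ∧
    -- the non-Archimedean part; `(p, l)` corresponds to `|n| = (p ^ ord_p n) ^ l`
    (∃ e : NonArch.space ≃o ((DiscreteTheory Nat.Primes).prod UpperRealNeg).space,
      ∀ (n : ℤ) (q : PosRat), n ≠ 0 →
        e (NonArch.opens (absLT n q)) =
          ((DiscreteTheory Nat.Primes).prod UpperRealNeg).opens
            (.or fun i : {i : Nat.Primes × ℚ //
                (((i.1 : ℕ) : ℝ) ^ padicValInt (i.1 : ℕ) n) ^ (i.2 : ℝ) < ((q : ℚ) : ℝ)} =>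
              .and (.atom (Sum.inl i.1.1)) (.atom (Sum.inr i.1.2)))) ∧
    -- the Archimedean part; `l` corresponds to `|n| = (magnitude of n) ^ l`
    (∃ e : Arch.space ≃o UpperRealUnit.space,
      ∀ (n : ℤ) (q : PosRat), n ≠ 0 →
        e (Arch.opens (absLT n q)) =
          UpperRealUnit.opens
            (.or fun r : {r : ℚ // (n.natAbs : ℝ) ^ (r : ℝ) < ((q : ℚ) : ℝ)} =>
              .atom r.1)) := by
  refine ⟨nonArch_space_eq, arch_space_eq, ?_, ?_, ?_, ?_⟩
  · rw [nonArch_space_eq, arch_space_eq]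
    exact inf_openSublocale_sup_closedSublocale _ _
  · rw [nonArch_space_eq, arch_space_eq]
    exact inf_openSublocale_inf_closedSublocale _ _
  · obtain ⟨e, he⟩ := exists_nonArch_orderIso
    refine ⟨e, fun n q hn => (he (n, q)).trans ?_⟩
    rw [padicFormula, if_neg hn]
  · obtain ⟨e, he⟩ := exists_arch_orderIso
    refine ⟨e, fun n q hn => (he (n, q)).trans ?_⟩
    rw [rpowFormula, if_neg hn]
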